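/- **Setting.** A combinatorial (oriented) surface is a finite graph $G$ (loops and multiple edges allowed) given by its arcs (directed edges; $a^{-1}$ is the arc opposite to $a$), with a clockwise cyclic order of the arcs leaving each vertex and a set of faces declared perforated. It is a system of quads if every non-perforated face is a quadrilateral and every vertex incident to no perforated face has degree at least $8$. Fix a system of quads. Homotopy of walks with fixed endpoints is generated by inserting and deleting spurs $aa^{-1}$ and facial walks of non-perforated faces; free homotopy of closed walks allows moreover cyclic shifts. Let $c$ be a closed walk of length $n\ge 1$, with vertices $c(t)$ and arcs $c[t,t+1]$ from $c(t)$ to $c(t+1)$, $t\in\mathbb Z/n\mathbb Z$; put $c[t+1,t]=c[t,t+1]^{-1}$. Write $[t,t+1]$ and $[t+1,t]$ for the corresponding arc occurrences, which are the two directions of one undirected occurrence. The turn of two arcs with the same origin is the number of face corners from the first to the second in clockwise order; the turn of $c$ at index $t$ is that of $(c[t,t-1],c[t,t+1])$. A bracket is a subpath of length $j$, $1\le j\le n$, whose $j+1$ turns (those at its two ends included) are $1,2,\dots,2,1$ or $-1,-2,\dots,-2,-1$ (possibly no $\pm2$), all corners counted being corners of non-perforated faces. The curve $c$ is geodesic if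 it has no spur (cyclically) and no bracket; it is primitive if it is not freely homotopic to $d^m$ for any closed walk $d$ and any $m\ge 2$. An immersion $\mathcal I$ of $c$ is the choice, for each arc $a$, of a left-to-right linear order on the occurrences of $a$ or $a^{-1}$ in $c$, opposite arcs having inverse orders. Concatenating these orders in clockwise order of the arcs leaving $v$ gives a circular order at $v$ on the occurrences leaving $v$. A double point is an unordered pair $\{i,j\}$ of distinct indices with $c(i)=c(j)$; it is a crossing if $[i,i-1],[j,j-1],[i,i+1],[j,j+1]$ appear in this circular order or its opposite. For an index $i$ and an integer $k\neq0$ of sign $\varepsilon$, the index path $(i,k)$ is $(i,i+\varepsilon,\dots,i+k)$ and its image path is $(c[i,i+\varepsilon],\dots,c[i+k-\varepsilon,i+k])$. A bigon of $\mathcal I$ is a pair of index paths $(i,\ell)$, $(j,k)$ with $\ell>0$, $k\ne0$ (the first side is taken forward without loss of generality, as both sides can be reversed), whose image paths are homotopic and whose tips $(i,j)$ and $(i+\ell,j+k)$ are crossings. It is singular if 1. the two index paths share no (undirected) arc occurrence; 2. when $j=i+\ell$, the occurrences $[i,i-1],[j,j-1],[i,i+1],[j+k,j+k+1],[j,j+1],[j+k,j+k-1]$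 do not appear in this circular order or its opposite at $c(j)$; 3. when $i=j+k$, the occurrences $[i,i-1],[j,j-1],[i+\ell,i+\ell-1],[i,i+1],[i+\ell,i+\ell+1],[j,j+1]$ do not appear in this circular order or its opposite at $c(i)$. When $k=\varepsilon\ell$ with $\varepsilon=\pm1$, swapping the two sides means exchanging the arc occurrences $[i+p,i+p+1]$ and $[j+\varepsilon p,j+\varepsilon(p+1)]$ for all $0\le p<\ell$: each takes the supporting arc of the other and its place in the left-to-right orders, while the other occurrences are unchanged. **Statement.** Let $\mathcal I$ be an immersion of a primitive geodesic closed curve $c$ on a system of quads, and let $(i,\ell),(j,k)$ be a singular bigon of $\mathcal I$. Then $|k|=\ell$, so that its sides can be swapped; the swap yields a closed curve with an immersion $\mathcal J$, and the number of crossings of $\mathcal J$ is at most the number of crossings of $\mathcal I$ minus $2$. -/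

import Mathlib

/-- A combinatorial oriented surface: a finite graph given by its arcs (directed edges, each edge
being two opposite arcs; loops and multiple edges allowed), a rotation system, and a flag telling
which faces are perforated. `rot a` is the arc that follows `a` in clockwise order among the arcs
with the same origin. -/
structure CombinatorialSurface (V A : Type*) where
  org : A → V
  inv : A → A
  rot : Equiv.Perm A
  inv_inv : ∀ a, inv (inv a) = a
  inv_ne : ∀ a, inv a ≠ a
  /-- the arcs with a given origin form exactly one cycle of the rotation system -/
  org_eq_iff : ∀ a b, org a = org b ↔ rot.SameCycle a b
  /-- the face whose facial walk runs through `a` (the face on the left of `a`) is perforated -/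
  perforated : A → Prop
  /-- perforation is a property of faces: it is constant along facial walks -/
  perforated_next : ∀ a, perforated (rot (inv a)) ↔ perforated a

namespace CombinatorialSurface

variable {V A : Type*} (S : CombinatorialSurface V A)

/-- Target vertex of an arc. -/
def tgt (a : A) : V := S.org (S.inv a)

/-- Face traversal: the successor of `a` in its facial walk. -/
def next (a : A) : A := S.rot (S.inv a)

/-- The facial walk starting with the arc `a` (one full turn around the face). -/
noncomputable def facialWalk (a : A) : List A :=
  (List.range (Function.minimalPeriod S.next a)).map fun m => S.next^[m] a

/-- A vertex is interior if it is incident to no perforated face (the corner between `rot⁻¹ a`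
and `a` belongs to the face of `a`). -/
def IsInteriorVertex (v : V) : Prop := ∀ a, S.org a = v → ¬ S.perforated a

/-- A system of quads: each non-perforated face is a quadrilateral and each interior vertex has
degree at least `8`. -/
def IsQuadSystem : Prop :=
  (∀ a, ¬ S.perforated a → Function.minimalPeriod S.next a = 4) ∧
    ∀ v, S.IsInteriorVertex v → 8 ≤ {a | S.org a = v}.ncard

/-! ### Walks and homotopy -/

/-- `IsWalk v p w`: the list of arcs `p` is a walk from `v` to `w`. -/
def IsWalk : V → List A → V → Prop
  | v, [], w => v = w
  | v, a :: p, w => S.org a = v ∧ IsWalk (S.tgt a) p w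

/-- Insertion of a spur, or of the facial walk of a non-perforated face. -/
inductive ElementaryStep : List A → List A → Prop
  | spur (u w : List A) (a : A) : ElementaryStep (u ++ w) (u ++ ([a, S.inv a] ++ w))
  | face (u w : List A) (a : A) (h : ¬ S.perforated a) :
      ElementaryStep (u ++ w) (u ++ (S.facialWalk a ++ w))

/-- Homotopy with fixed endpoints for walks from `v` to `w`. -/
def PathHomotopic (v w : V) : List A → List A → Prop :=
  Relation.EqvGen fun p q => S.IsWalk v p w ∧ S.IsWalk v q w ∧ S.ElementaryStep p q

/-- Elementary free homotopies of closed walks, a closed walk being given with its base point. -/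
inductive FreeStep : V × List A → V × List A → Prop
  | elementary (v : V) (p q : List A) (hp : S.IsWalk v p v) (hq : S.IsWalk v q v)
      (h : S.ElementaryStep p q) : FreeStep (v, p) (v, q)
  | shift (a : A) (p : List A) (h : S.IsWalk (S.org a) (a :: p) (S.org a)) :
      FreeStep (S.org a, a :: p) (S.tgt a, p ++ [a])

/-- Free homotopy of closed walks. -/
def FreelyHomotopic : V × List A → V × List A → Prop := Relation.EqvGen S.FreeStep

/-! ### Closed curves

A closed curve of length `n` is given by `c : ZMod n → A`, where `c t` is the arc that joins the
vertex of index `t` to the vertex of index `t + 1`; the vertex of index `t` is `S.org (c t)`. -/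

variable {n : ℕ}

def IsClosedCurve (c : ZMod n → A) : Prop := ∀ t, S.tgt (c t) = S.org (c (t + 1))

/-- Index of the `p`-th arc occurrence (`p = 0, 1, …`) of the index path of signed length `k`
starting at `i`: the path is forward if `0 < k`, and backward otherwise. The arc occurrence between
the indices `t` and `t + 1` is referred to by `t`. -/
def pathIndex (i : ZMod n) (k : ℤ) (p : ℕ) : ZMod n :=
  if 0 < k then i + p else i - p - 1

/-- The `p`-th arc of the image of the index path of signed length `k` starting at `i`. -/
def pathArc (c : ZMod n → A) (i : ZMod n) (k : ℤ) (p : ℕ) : A :=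
  if 0 < k then c (pathIndex i k p) else S.inv (c (pathIndex i k p))

/-- The image path of the index path of signed length `k` starting at `i`. -/
def imagePath (c : ZMod n → A) (i : ZMod n) (k : ℤ) : List A :=
  (List.range k.natAbs).map (S.pathArc c i k)

/-- A closed curve is primitive if its free homotopy class is not a proper power. -/
def IsPrimitive (c : ZMod n → A) : Prop :=
  ∀ (v : V) (d : List A), S.IsWalk v d v → ∀ m : ℕ, 2 ≤ m →
    ¬ S.FreelyHomotopic (S.org (c 0), S.imagePath c 0 n) (v, (List.replicate m d).flatten)

/-- `b` is reached from `a` by crossing `m` face corners clockwise around their origin, all these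
corners belonging to non-perforated faces. -/
def Corners (m : ℕ) (a b : A) : Prop :=
  b = (S.rot ^ m) a ∧ ∀ r < m, ¬ S.perforated ((S.rot ^ (r + 1)) a)

/-- The turn of `(a⁻¹, b)` is `m` (for consecutive arcs `a`, `b` of a curve). -/
def TurnPos (m : ℕ) (a b : A) : Prop := S.Corners m (S.inv a) b

/-- The turn of `(a⁻¹, b)` is `-m`. -/
def TurnNeg (m : ℕ) (a b : A) : Prop := S.Corners m b (S.inv a)

def HasSpur (c : ZMod n → A) : Prop := ∃ t, c (t + 1) = S.inv (c t)

/-- The subpath `c (t + 1), …, c (t + j)`, `1 ≤ j ≤ n`, has a turn sequence (of `j + 1` turns) of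
the form `1 2 ⋯ 2 1` or `-1 -2 ⋯ -2 -1`, possibly without any `±2`. -/
def HasBracket (c : ZMod n → A) : Prop :=
  ∃ (t : ZMod n) (j : ℕ), 1 ≤ j ∧ j ≤ n ∧
    ((S.TurnPos 1 (c t) (c (t + 1)) ∧
        (∀ r : ℕ, 1 ≤ r → r < j → S.TurnPos 2 (c (t + r)) (c (t + r + 1))) ∧
        S.TurnPos 1 (c (t + j)) (c (t + j + 1))) ∨
      (S.TurnNeg 1 (c t) (c (t + 1)) ∧
        (∀ r : ℕ, 1 ≤ r → r < j → S.TurnNeg 2 (c (t + r)) (c (t + r + 1))) ∧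
        S.TurnNeg 1 (c (t + j)) (c (t + j + 1))))

/-- A closed curve is geodesic if it has no spurs and no brackets. -/
def IsGeodesic (c : ZMod n → A) : Prop := ¬ S.HasSpur c ∧ ¬ S.HasBracket c

/-! ### Immersions and crossings -/

/-- `t` is (the index of) an occurrence of `a` or of its opposite in `c`. -/
def Occurs (c : ZMod n → A) (a : A) (t : ZMod n) : Prop := c t = a ∨ c t = S.inv a

/-- A combinatorial immersion of `c`: for each arc `a` a (strict) left-to-right order `left a` on
the occurrences of `a` or its opposite in `c`, with inverse orders on opposite arcs. -/
structure IsImmersion (c : ZMod n → A) (left : A → ZMod n → ZMod n → Prop) : Prop where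
  irrefl : ∀ a s, S.Occurs c a s → ¬ left a s s
  trans : ∀ a r s t, S.Occurs c a r → S.Occurs c a s → S.Occurs c a t →
    left a r s → left a s t → left a r t
  total : ∀ a s t, S.Occurs c a s → S.Occurs c a t → s ≠ t → left a s t ∨ left a t s
  opposite : ∀ a s t, S.Occurs c a s → S.Occurs c a t → (left (S.inv a) s t ↔ left a t s)

/-- The arc of `G` supporting a directed arc occurrence: `(t, true)` is the occurrence
`[t, t + 1]` and `(t, false)` is the occurrence `[t + 1, t]`, traversed backwards. -/
def dartArc (c : ZMod n → A) (x : ZMod n × Bool) : A :=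
  if x.2 then c x.1 else S.inv (c x.1)

/-- The occurrence `[i, i + 1]`. -/
def fwd (i : ZMod n) : ZMod n × Bool := (i, true)

/-- The occurrence `[i, i - 1]`. -/
def bwd (i : ZMod n) : ZMod n × Bool := (i - 1, false)

/-- Number of clockwise steps from `a` to `b` around their common origin. -/
noncomputable def rank (a b : A) : ℕ := sInf {m : ℕ | (S.rot ^ m) a = b}

/-- Order of the outgoing occurrences at the origin of `a₀` obtained by concatenating the
left-to-right orders of the arcs in clockwise order, starting with `a₀`. -/
def Before (c : ZMod n → A) (left : A → ZMod n → ZMod n → Prop) (a₀ : A)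
    (x y : ZMod n × Bool) : Prop :=
  S.rank a₀ (S.dartArc c x) < S.rank a₀ (S.dartArc c y) ∨
    (S.dartArc c x = S.dartArc c y ∧ left (S.dartArc c x) x.1 y.1)

/-- The occurrences in `L` leave the same vertex and appear in this order in the circular order
induced by the immersion at that vertex. -/
def InCircularOrder (c : ZMod n → A) (left : A → ZMod n → ZMod n → Prop)
    (L : List (ZMod n × Bool)) : Prop :=
  ∃ a₀ : A, (∀ x ∈ L, S.org (S.dartArc c x) = S.org a₀) ∧
    ∃ r : ℕ, (L.rotate r).Pairwise (S.Before c left a₀)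

/-- The same, up to reversing the circular order. -/
def InCircularOrderOrOpposite (c : ZMod n → A) (left : A → ZMod n → ZMod n → Prop)
    (L : List (ZMod n × Bool)) : Prop :=
  S.InCircularOrder c left L ∨ S.InCircularOrder c left L.reverse

/-- The double point `(i, j)` of `c` is a crossing of the immersion. -/
def IsCrossing (c : ZMod n → A) (left : A → ZMod n → ZMod n → Prop) (i j : ZMod n) : Prop :=
  i ≠ j ∧ S.org (c i) = S.org (c j) ∧
    S.InCircularOrderOrOpposite c left [bwd i, bwd j, fwd i, fwd j]

/-- The number of crossings; `(i, j)` and `(j, i)` are the same double point. -/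
noncomputable def crossingNumber (c : ZMod n → A) (left : A → ZMod n → ZMod n → Prop) : ℕ :=
  {z : Sym2 (ZMod n) | ∃ i j, z = s(i, j) ∧ S.IsCrossing c left i j}.ncard

/-! ### Singular bigons and their swapping -/

/-- The index paths of signed lengths `ℓ > 0` from `i` and `k ≠ 0` from `j` form a bigon. (The first
side can be taken forward, since both sides of a bigon can be reversed.) -/
structure IsBigon (c : ZMod n → A) (left : A → ZMod n → ZMod n → Prop)
    (i : ZMod n) (ℓ : ℕ) (j : ZMod n) (k : ℤ) : Prop where
  length_pos : 0 < ℓ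
  length_ne : k ≠ 0
  homotopic : S.PathHomotopic (S.org (c i)) (S.org (c (i + ℓ)))
    (S.imagePath c i ℓ) (S.imagePath c j k)
  tip_start : S.IsCrossing c left i j
  tip_end : S.IsCrossing c left (i + ℓ) (j + k)

/-- A singular bigon. -/
structure IsSingularBigon (c : ZMod n → A) (left : A → ZMod n → ZMod n → Prop)
    (i : ZMod n) (ℓ : ℕ) (j : ZMod n) (k : ℤ) : Prop extends S.IsBigon c left i ℓ j k where
  disjoint : ∀ p < ℓ, ∀ q < k.natAbs, pathIndex i ℓ p ≠ pathIndex j k q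
  not_end_start : j = i + ℓ → ¬ S.InCircularOrderOrOpposite c left
    [bwd i, bwd j, fwd i, fwd (j + k), fwd j, bwd (j + k)]
  not_start_end : i = j + k → ¬ S.InCircularOrderOrOpposite c left
    [bwd i, bwd j, bwd (i + ℓ), fwd i, fwd (i + ℓ), fwd j]

/-- The position of the arc occurrence `t` along the forward (`0 < k`) or backward index path
starting at `j`: for `p < n` one has `pathPos j k t = p` iff `t = pathIndex j k p`. -/
def pathPos (j : ZMod n) (k : ℤ) (t : ZMod n) : ℕ :=
  if 0 < k then (t - j).val else (j - 1 - t).val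

/-- The exchange of the `p`-th arc occurrences of the two sides, for `0 ≤ p < ℓ`; the other
occurrences are fixed. Only used for sides of the same length `ℓ = |k|` without common arc
occurrence. -/
def swapIndex (i : ZMod n) (ℓ : ℕ) (j : ZMod n) (k : ℤ) (t : ZMod n) : ZMod n :=
  if pathPos i ℓ t < ℓ then pathIndex j k (pathPos i ℓ t)
  else if pathPos j k t < ℓ then pathIndex i ℓ (pathPos j k t)
  else t

/-- The curve after swapping: each side follows the former image path of the other one. If the
sides have opposite directions, the exchanged occurrences are traversed in opposite directions. -/
def swapCurve (c : ZMod n → A) (i : ZMod n) (ℓ : ℕ) (j : ZMod n) (k : ℤ) (t : ZMod n) : A :=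
  if (pathPos i ℓ t < ℓ ∨ pathPos j k t < ℓ) ∧ k < 0 then S.inv (c (swapIndex i ℓ j k t))
  else c (swapIndex i ℓ j k t)

/-- The left-to-right orders after swapping: each exchanged occurrence takes the place of the
other one. -/
def swapOrder (left : A → ZMod n → ZMod n → Prop) (i : ZMod n) (ℓ : ℕ) (j : ZMod n) (k : ℤ) :
    A → ZMod n → ZMod n → Prop :=
  fun a s t => left a (swapIndex i ℓ j k s) (swapIndex i ℓ j k t)

end CombinatorialSurface

/-! The two claims are proved by separate arguments: a combinatorial nonpositive curvature argument
gives the equality of lengths, and a count of crossing chords shows that two crossings disappear.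

Lengths. Join two arcs at a vertex when they bound a corner of a non-perforated face. The degree
condition excludes loops, double edges and triangles from these links (`squareRelation`), as for a
nonpositively curved square complex. A substitute for the universal cover is built by hand: its
vertices are words moving away from an origin, up to pushing across squares, and every arc acts on
it by a permutation. Words need not be composable in the surface, as if all vertices had been
merged; the link is then the disjoint union of the vertex links. Spurs and squares act trivially, so
homotopic paths have the same action. Good words are exactly the shortest ones for their action
(`good_iff_shortest`). A subpath of length at most `n` of a geodesic is good, because a failure
would exhibit a spur or a bracket (`desc_forwardPath`). The sides of a singular bigon have no common
occurrence, so they have length at most `n`; being homotopic, they have the same length.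

Crossings. Each index is a chord joining its two darts on the circle of darts at a vertex, and
crossings are interleaved chords. Relabelling all darts of the two sides leaves the picture
unchanged except at the tips: the swap only re-pairs the ends of the two chords at each tip
(`DisjointSides.conj_partner`). Re-pairing two crossing chords into disjoint ones removes their
crossing and adds none with a third chord (`chordCount_uncross`). If the tips have no index in
common, this applies twice.

The delicate case is that of consecutive sides, say `j = i + ℓ`, where both tips involve the chord
of `j`, and undoing one crossing might destroy the other. The tips can be uncrossed in either order.
If neither order works, the six darts are in the cyclic order excluded by the definition of
singularity. This uses that the initial arcs of the sides are equal or neighbours in the rotation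
and that no reversed final arc equals either of them (`arcs_of_consecutive_homotopic`). Primitivity
ensures that the three indices are distinct; otherwise the curve would be freely homotopic to the
square of a closed walk. -/

/-! ### Shortest words in square complexes with triangle-free links -/

/-- The boundary words `a b c d` of the squares of a square complex whose vertex links are simple
graphs without triangles. Only the arcs and their inverses are recorded. -/
structure SquareRelation {A : Type*} (inv : A → A) (Q : A → A → A → A → Prop) : Prop where
  inv_inv : ∀ a, inv (inv a) = a
  cyc : ∀ {a b c d}, Q a b c d → Q b c d a
  rev : ∀ {a b c d}, Q a b c d → Q (inv d) (inv c) (inv b) (inv a)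
  det : ∀ {a b c d c' d'}, Q a b c d → Q a b c' d' → c = c' ∧ d = d'
  noLoop : ∀ {a c d}, ¬ Q a (inv a) c d
  noTriangle : ∀ {x y z c d c' d' c'' d''},
    Q (inv x) y c d → Q (inv y) z c' d' → ¬ Q (inv x) z c'' d''

namespace SquareRelation

variable {A : Type*} (inv : A → A) (Q : A → A → A → A → Prop)

/-! Words are written backwards: the head of the list is the last arc of the path. -/

/-- The arcs `d` leaving the end of the word `w` towards the origin of `w`. -/
def Desc : List A → A → Prop
  | [], _ => False
  | b :: w, d => d = inv b ∨ ∃ e f, Desc w e ∧ Q (inv e) b d f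

/-- Words each of whose arcs moves away from the origin. -/
def Good : List A → Prop
  | [] => True
  | b :: w => Good w ∧ ¬ Desc inv Q w b

/-- Equivalence of words under pushing across squares. -/
inductive FlipEquiv : List A → List A → Prop
  | nil : FlipEquiv [] []
  | cons (a : A) {p q : List A} : FlipEquiv p q → FlipEquiv (a :: p) (a :: q)
  | flip {a b e e' : A} {p q u : List A} : FlipEquiv p (e' :: u) → FlipEquiv q (e :: u) →
      Q e' a (inv b) (inv e) → FlipEquiv (a :: p) (b :: q)

variable {inv Q} (h : SquareRelation inv Q)

include h in
theorem adj_symm {x y c d : A} (H : Q (inv x) y c d) : Q (inv y) x (inv d) (inv c) := by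
  simpa [h.inv_inv] using h.cyc (h.cyc (h.rev H))

theorem FlipEquiv.refl (p : List A) : FlipEquiv inv Q p p := by
  induction p with
  | nil => exact .nil
  | cons a p ih => exact .cons a ih

include h in
theorem FlipEquiv.symm {p q : List A} (H : FlipEquiv inv Q p q) : FlipEquiv inv Q q p := by
  induction H with
  | nil => exact .nil
  | cons a _ ih => exact .cons a ih
  | flip h1 h2 hq ih1 ih2 =>
    exact .flip h2 h1 (by simpa [h.inv_inv] using h.rev hq)

theorem FlipEquiv.length_eq {p q : List A} (H : FlipEquiv inv Q p q) : p.length = q.length := by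
  induction H with
  | nil => rfl
  | cons a _ ih => simp [ih]
  | flip h1 h2 hq ih1 ih2 => simp_all

-- A third descending arc would come from an arc `g` descending at the end of `e'`. Then `inv e'`,
-- `g` and `a` would be pairwise adjacent in the link there, a triangle.
include h in
theorem desc_of_flip {a b e e' : A} {p u : List A}
    (hD : ∀ d, Desc inv Q p d ↔ Desc inv Q (e' :: u) d)
    (hq : Q e' a (inv b) (inv e)) (d : A) :
    Desc inv Q (a :: p) d ↔ d = inv a ∨ d = inv b := by
  simp only [Desc]
  constructor
  · rintro (rfl | ⟨g, f, hg, hgq⟩)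
    · exact .inl rfl
    · rw [hD] at hg
      simp only [Desc] at hg
      rcases hg with rfl | ⟨k, f', -, hk⟩
      · rw [h.inv_inv] at hgq
        exact .inr (h.det hgq hq).1
      · refine absurd (h.adj_symm hgq) fun h1 => ?_
        have h2 : Q (inv (inv e')) g f' (inv k) := by
          rw [h.inv_inv]; exact h.cyc hk
        have h3 : Q (inv (inv e')) a (inv b) (inv e) := by rw [h.inv_inv]; exact hq
        exact h.noTriangle h2 hgq h3
  · rintro (rfl | rfl)
    · exact .inl rfl
    · refine .inr ⟨inv e', inv e, ?_, by rwa [h.inv_inv]⟩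
      rw [hD]
      exact .inl rfl

-- The square transfers descents: if `e` descended from `u`, then `a` would descend from `e' :: u`;
-- if `b` descended from `e :: u`, then by `det` the arc `e'` would descend from `u`.
include h in
theorem good_of_flip {a b e e' : A} {p q u : List A}
    (hDp : ∀ d, Desc inv Q p d ↔ Desc inv Q (e' :: u) d)
    (hDq : ∀ d, Desc inv Q q d ↔ Desc inv Q (e :: u) d)
    (hGp : Good inv Q p ↔ Good inv Q (e' :: u)) (hGq : Good inv Q q ↔ Good inv Q (e :: u))
    (hq : Q e' a (inv b) (inv e)) (H : Good inv Q (a :: p)) : Good inv Q (b :: q) := by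
  obtain ⟨h1, h2⟩ := H
  rw [hGp] at h1
  rw [hDp] at h2
  have hr : Q (inv e') e b (inv a) := by
    simpa [h.inv_inv] using h.cyc (h.cyc (h.cyc (h.rev hq)))
  refine ⟨hGq.2 ⟨h1.1, fun he => h2 (.inr ⟨e, inv b, he, h.cyc (h.cyc (h.cyc hq))⟩)⟩, ?_⟩
  rw [hDq]
  rintro (rfl | ⟨g, f, hg, hgq⟩)
  · exact h.noLoop (h.cyc hr)
  · have : inv g = inv e' := (h.det (h.cyc hgq) (h.cyc hr)).2
    have : g = e' := by rw [← h.inv_inv g, this, h.inv_inv]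
    exact h1.2 (this ▸ hg)

-- Makes descending arcs and goodness well defined on flip classes, hence on the vertices of the
-- cover.
include h in
theorem FlipEquiv.desc_good {p q : List A} (H : FlipEquiv inv Q p q) :
    (∀ d, Desc inv Q p d ↔ Desc inv Q q d) ∧ (Good inv Q p ↔ Good inv Q q) := by
  induction H with
  | nil => simp
  | cons a _ ih => simp [Desc, Good, ih]
  | @flip a b e e' p q u h1 h2 hq ih1 ih2 =>
    have hq' : Q e b (inv a) (inv e') := by simpa [h.inv_inv] using h.rev hq
    refine ⟨fun d => ?_, ?_, ?_⟩
    · rw [h.desc_of_flip ih1.1 hq, h.desc_of_flip ih2.1 hq', or_comm]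
    · exact h.good_of_flip ih1.1 ih2.1 ih1.2 ih2.2 hq
    · exact h.good_of_flip ih2.1 ih1.1 ih2.2 ih1.2 hq'

include h in
theorem FlipEquiv.cancel {a : A} {p q : List A} (H : FlipEquiv inv Q (a :: p) (a :: q)) :
    FlipEquiv inv Q p q := by
  cases H with
  | cons _ h1 => exact h1
  | flip h1 h2 hq => exact absurd (h.cyc hq) h.noLoop

-- Transitivity is not built into `FlipEquiv`, which allows one flip at the head, after equivalences
-- of the tails. Two successive head flips must use the same square, by the absence of link
-- triangles, so they cancel.
include h in
theorem FlipEquiv.trans_aux (m : ℕ) : ∀ {x y z : List A}, y.length = m →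
    FlipEquiv inv Q x y → FlipEquiv inv Q y z → FlipEquiv inv Q x z := by
  induction m with
  | zero =>
    intro x y z hy h1 h2
    cases h1 with
    | nil => exact h2
    | cons => simp at hy
    | flip => simp at hy
  | succ m ih =>
    intro x y z hy h1 h2
    cases h1 with
    | nil => simp at hy
    | @cons a p q h1 =>
      have hy' : q.length = m := by simpa using hy
      cases h2 with
      | cons _ h2 => exact .cons _ (ih hy' h1 h2)
      | flip h2 h3 hq => exact .flip (ih hy' h1 h2) h3 hq
    | @flip a b e e' p q u h1 h3 hq =>
      have hy' : q.length = m := by simpa using hy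
      cases h2 with
      | cons _ h2 => exact .flip h1 (ih hy' (h2.symm h) h3) hq
      | @flip _ c g g' _ r v h4 h5 hq2 =>
        have hu := ih hy' (h3.symm h) h4
        have hq' : Q e b (inv a) (inv e') := by simpa [h.inv_inv] using h.rev hq
        -- Otherwise `e :: u` and `g' :: v` are themselves related by a head flip, whose square
        -- makes `inv e`, `inv g'`, `b` a triangle.
        have heg : e = g' := by
          by_contra hne
          cases hu with
          | cons => exact hne rfl
          | flip _ _ hq3 =>
            refine h.noTriangle (x := inv e) (y := inv g') (z := b)
              ((h.inv_inv e).symm ▸ h.cyc hq3) ((h.inv_inv g').symm ▸ hq2)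
              ((h.inv_inv e).symm ▸ hq')
        subst heg
        obtain ⟨h6, h7⟩ := h.det hq' hq2
        have hac : a = c := by rw [← h.inv_inv a, h6, h.inv_inv]
        have heg : e' = g := by rw [← h.inv_inv e', h7, h.inv_inv]
        subst hac heg
        have huv := hu.cancel h
        have l1 : (e' :: u).length = m := by
          have := h3.length_eq; simp at this ⊢; omega
        have l2 : (e' :: v).length = m := by
          have := h5.length_eq; have := h4.length_eq; simp at *; omega
        exact .cons _ (ih l2 (ih l1 h1 (.cons _ huv)) (h5.symm h))

include h in
theorem FlipEquiv.trans {x y z : List A} (h1 : FlipEquiv inv Q x y) (h2 : FlipEquiv inv Q y z) :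
    FlipEquiv inv Q x z := FlipEquiv.trans_aux h _ rfl h1 h2

-- Induction lifts the descending arc `e` of the shorter word to a last arc `inv e`, which the
-- square then pushes past `b`.
include h in
theorem exists_flipEquiv_of_desc {g : List A} {d : A} (H : Desc inv Q g d) :
    ∃ g', FlipEquiv inv Q g (inv d :: g') := by
  induction g generalizing d with
  | nil => exact H.elim
  | cons b w ih =>
    rcases H with rfl | ⟨e, f, he, hq⟩
    · exact ⟨w, by rw [h.inv_inv]; exact .refl _⟩
    · obtain ⟨u, hu⟩ := ih he
      exact ⟨inv f :: u, .flip hu (.refl _) (by simpa [h.inv_inv] using hq)⟩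

/-! ### The vertices of the universal cover and the action of the arcs -/

/-- Flip equivalence on good words. -/
def setoid : Setoid {w : List A // Good inv Q w} where
  r p q := FlipEquiv inv Q p.1 q.1
  iseqv := ⟨fun p => .refl p.1, fun H => H.symm h, fun H1 H2 => H1.trans h H2⟩

/-- Good words up to flip equivalence. -/
def Cover : Type _ := Quotient h.setoid

/-- The class of a good word. -/
def pt (w : List A) (hw : Good inv Q w) : h.Cover := Quotient.mk h.setoid ⟨w, hw⟩

theorem pt_eq_pt {p q : List A} {hp : Good inv Q p} {hq : Good inv Q q} :
    h.pt p hp = h.pt q hq ↔ FlipEquiv inv Q p q := Quotient.eq (r := h.setoid)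

/-- Length of a vertex: the length of the good words representing it. -/
def level : h.Cover → ℕ :=
  Quotient.lift (fun w : {w : List A // Good inv Q w} => w.1.length)
    fun _ _ H => FlipEquiv.length_eq H

theorem exists_pt (x : h.Cover) : ∃ w hw, x = h.pt w hw := by
  obtain ⟨⟨w, hw⟩, rfl⟩ := Quotient.exists_rep x
  exact ⟨w, hw, rfl⟩

theorem level_pt (w : List A) (hw : Good inv Q w) : h.level (h.pt w hw) = w.length := rfl

/-- The arc `a` leads from `x` to `y` and moves away from the origin. -/
def Up (a : A) (x y : h.Cover) : Prop :=
  ∃ (w : List A) (hw : Good inv Q (a :: w)), x = h.pt w hw.1 ∧ y = h.pt (a :: w) hw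

/-- The arc `a` leads from `x` to `y`. -/
def Step (a : A) (x y : h.Cover) : Prop := h.Up a x y ∨ h.Up (inv a) y x

variable {h}

theorem Step.symm {a : A} {x y : h.Cover} (H : h.Step a x y) : h.Step (inv a) y x := by
  unfold Step at *
  rw [h.inv_inv]
  exact H.symm

theorem Up.unique {a : A} {x y y' : h.Cover} (H : h.Up a x y) (H' : h.Up a x y') : y = y' := by
  obtain ⟨w, hw, hx, rfl⟩ := H
  obtain ⟨w', hw', hx', rfl⟩ := H'
  rw [hx, pt_eq_pt] at hx'
  exact h.pt_eq_pt.2 (.cons _ hx')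

theorem Up.unique_left {a : A} {x x' y : h.Cover} (H : h.Up a x y) (H' : h.Up a x' y) :
    x = x' := by
  obtain ⟨w, hw, rfl, hx⟩ := H
  obtain ⟨w', hw', rfl, hx'⟩ := H'
  rw [hx, pt_eq_pt] at hx'
  exact h.pt_eq_pt.2 (hx'.cancel h)

/-- Being descending depends only on the flip class, so an arc cannot both ascend and descend at the
same vertex. This is what makes the target of an arc unique. -/
theorem Up.not_up_inv {a : A} {x y y' : h.Cover} (H : h.Up a x y) (H' : h.Up (inv a) y' x) :
    False := by
  obtain ⟨w, hw, hx, rfl⟩ := H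
  obtain ⟨w', hw', rfl, hx'⟩ := H'
  rw [hx, pt_eq_pt] at hx'
  refine hw.2 (((hx'.desc_good h).1 a).2 (.inl ?_))
  rw [h.inv_inv]

theorem Step.unique {a : A} {x y y' : h.Cover} (H : h.Step a x y) (H' : h.Step a x y') :
    y = y' := by
  rcases H with H | H <;> rcases H' with H' | H'
  · exact H.unique H'
  · exact (H.not_up_inv H').elim
  · exact (H'.not_up_inv H).elim
  · exact H.unique_left H'

theorem exists_step (a : A) (x : h.Cover) : ∃ y, h.Step a x y := by
  obtain ⟨w, hw, rfl⟩ := h.exists_pt x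
  by_cases hd : Desc inv Q w a
  · obtain ⟨g, hg⟩ := h.exists_flipEquiv_of_desc hd
    have hG := (hg.desc_good h).2.1 hw
    exact ⟨h.pt g hG.1, .inr ⟨g, hG, rfl, h.pt_eq_pt.2 hg⟩⟩
  · exact ⟨h.pt (a :: w) ⟨hw, hd⟩, .inl ⟨w, ⟨hw, hd⟩, rfl, rfl⟩⟩

/-- The two words for `y` have different last arcs, so they differ by a head flip, and `det`
identifies its square with the given one. -/
theorem Up.square_of_peak {a b c d : A} {x y z : h.Cover} (hq : Q a b c d) (h1 : h.Up a x y)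
    (h2 : h.Up (inv b) z y) : ∃ u, h.Up d u x ∧ h.Up (inv c) u z := by
  obtain ⟨p, hp, rfl, rfl⟩ := h1
  obtain ⟨q, hq', rfl, hy⟩ := h2
  rw [pt_eq_pt] at hy
  obtain ⟨b', hb⟩ : ∃ b', inv b = b' := ⟨_, rfl⟩
  rw [hb] at hy
  cases hy with
  | cons _ _ =>
    have : b = inv a := by rw [← hb, h.inv_inv]
    subst this
    exact (h.noLoop hq).elim
  | @flip _ _ e e' _ _ u h1 h2 h3 =>
    subst hb
    rw [h.inv_inv] at h3
    obtain ⟨hce, hde⟩ := h.det hq (h.cyc h3)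
    have hc : inv c = e := by rw [hce, h.inv_inv]
    subst hc hde
    have g1 := (h1.desc_good h).2.1 hp.1
    have g2 := (h2.desc_good h).2.1 hq'.1
    exact ⟨h.pt u g1.1, ⟨u, g1, rfl, h.pt_eq_pt.2 h1⟩, ⟨u, g2, rfl, h.pt_eq_pt.2 h2⟩⟩

theorem Up.square_of_valley {a b c d : A} {x y z w x' : h.Cover} (hq : Q a b c d)
    (h1 : h.Up (inv a) y x) (h2 : h.Up (inv b) z y) (h3 : h.Up c z w) (h4 : h.Up d w x') :
    x' = x := by
  obtain ⟨p1, g1, rfl, rfl⟩ := h1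
  obtain ⟨p2, g2, rfl, e2⟩ := h2
  obtain ⟨p3, g3, e3, rfl⟩ := h3
  obtain ⟨p4, g4, e4, rfl⟩ := h4
  rw [pt_eq_pt] at *
  refine FlipEquiv.symm h (.flip e2 ((e4.symm h).trans h (.cons c (e3.symm h))) ?_)
  exact h.cyc (h.cyc (h.rev hq))

/-- After climbing `a` and `b`, the side `c` is opposite to `a` in the square, hence descends. -/
theorem Up.not_three {a b c d : A} {x y z w : h.Cover} (hq : Q a b c d)
    (h1 : h.Up a x y) (h2 : h.Up b y z) (h3 : h.Up c z w) : False := by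
  obtain ⟨p1, g1, rfl, rfl⟩ := h1
  obtain ⟨p2, g2, e2, rfl⟩ := h2
  obtain ⟨p3, g3, e3, rfl⟩ := h3
  rw [pt_eq_pt] at *
  refine g3.2 (((e3.desc_good h).1 c).1 (.inr ⟨inv a, d, ?_, by rwa [h.inv_inv]⟩))
  exact ((e2.desc_good h).1 _).1 (.inl rfl)

/-- Each side changes the level by one. Three successive climbs (or descents) are impossible, a peak
lets the square be completed below it, and two descents followed by two climbs are a flip. -/
theorem Step.square {a b c d : A} {x y z w x' : h.Cover} (hq : Q a b c d)
    (h1 : h.Step a x y) (h2 : h.Step b y z) (h3 : h.Step c z w) (h4 : h.Step d w x') :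
    x' = x := by
  have hr : Q (inv c) (inv b) (inv a) (inv d) := h.cyc (h.rev hq)
  have hr' : Q (inv d) (inv c) (inv b) (inv a) := h.rev hq
  have s1 := h1.symm
  have s2 := h2.symm
  rcases h1 with h1 | h1 <;> rcases h2 with h2 | h2 <;> rcases h3 with h3 | h3
  · exact (h1.not_three hq h2 h3).elim
  · obtain ⟨u, hu1, hu2⟩ := h2.square_of_peak (h.cyc hq) h3
    have : u = x := Step.unique (a := inv a) (.inr (by rwa [h.inv_inv])) s1
    subst this
    exact h4.unique (.inr hu2)
  · obtain ⟨u, hu1, hu2⟩ := h1.square_of_peak hq h2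
    have : w = u := Step.unique (a := c) (.inl h3) (.inr hu2)
    subst this
    exact h4.unique (.inl hu1)
  · obtain ⟨u, hu1, hu2⟩ := h1.square_of_peak hq h2
    have : w = u := Step.unique (a := c) (.inr h3) (.inr hu2)
    subst this
    exact h4.unique (.inl hu1)
  · rcases h4 with h4 | h4
    · exact (h2.not_three (h.cyc hq) h3 h4).elim
    · obtain ⟨u, hu1, hu2⟩ := h3.square_of_peak (h.cyc (h.cyc hq)) h4
      have : u = y := Step.unique (a := inv b) (.inr (by rwa [h.inv_inv])) s2
      subst this
      exact hu2.unique h1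
  · obtain ⟨u, hu1, hu2⟩ := h2.square_of_peak (h.cyc hq) h3
    have : u = x := Step.unique (a := inv a) (.inr (by rwa [h.inv_inv])) s1
    subst this
    exact h4.unique (.inr hu2)
  · rcases h4 with h4 | h4
    · exact h1.square_of_valley hq h2 h3 h4
    · obtain ⟨u, hu1, hu2⟩ := h3.square_of_peak (h.cyc (h.cyc hq)) h4
      have : u = y := Step.unique (a := inv b) (.inr (by rwa [h.inv_inv])) s2
      subst this
      exact hu2.unique h1
  · exact (h3.not_three hr h2 h1).elim

variable (h)

/-- The action of the arcs on the vertices of the universal cover. -/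
noncomputable def act (a : A) : Equiv.Perm h.Cover where
  toFun x := (exists_step a x).choose
  invFun x := (exists_step (inv a) x).choose
  left_inv x := (exists_step (inv a) _).choose_spec.unique (exists_step a x).choose_spec.symm
  right_inv x := (exists_step a _).choose_spec.unique
    (by simpa [h.inv_inv] using (exists_step (inv a) x).choose_spec.symm)

theorem step_act (a : A) (x : h.Cover) : h.Step a x (h.act a x) := (exists_step a x).choose_spec

theorem act_inv (a : A) : h.act (inv a) = (h.act a)⁻¹ := by
  ext x
  exact (h.step_act (inv a) x).unique (exists_step (inv a) x).choose_spec

/-- The action of a path (written forwards). -/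
noncomputable def run (p : List A) : Equiv.Perm h.Cover := (p.reverse.map h.act).prod

theorem run_nil : h.run [] = 1 := rfl

theorem run_append (p q : List A) : h.run (p ++ q) = h.run q * h.run p := by simp [run]

theorem run_cons (a : A) (p : List A) : h.run (a :: p) = h.run p * h.act a := by simp [run]

theorem run_inverse (p : List A) : h.run (p.map inv).reverse = (h.run p)⁻¹ := by
  induction p with
  | nil => simp [run]
  | cons a p ih => simp [run_append, run_cons, ih, act_inv, run_nil]

theorem run_square {a b c d : A} (hq : Q a b c d) : h.run [a, b, c, d] = 1 := by
  ext x
  exact Step.square hq (h.step_act a _) (h.step_act b _) (h.step_act c _) (h.step_act d _)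

/-- The origin of the universal cover. -/
def origin : h.Cover := h.pt [] trivial

theorem run_good {p : List A} (hp : Good inv Q p.reverse) :
    h.run p h.origin = h.pt p.reverse hp := by
  induction p using List.reverseRecOn with
  | nil => rfl
  | append_singleton p a ih =>
    have hp' : Good inv Q (a :: p.reverse) := by simpa using hp
    rw [run_append]
    simp only [Equiv.Perm.mul_apply, ih hp'.1]
    simp only [run_cons, run_nil, one_mul, List.reverse_append, List.reverse_singleton,
      List.singleton_append]
    exact (h.step_act a _).unique (.inl ⟨_, hp', rfl, rfl⟩)

theorem level_act_le (a : A) (x : h.Cover) : h.level (h.act a x) ≤ h.level x + 1 := by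
  rcases h.step_act a x with ⟨w, hw, rfl, hy⟩ | ⟨w, hw, hx, hy⟩
  · rw [hy]; simp [level_pt]
  · rw [hx, hy]; simp [level_pt]; try omega

theorem level_run_le (p : List A) (x : h.Cover) : h.level (h.run p x) ≤ h.level x + p.length := by
  induction p generalizing x with
  | nil => simp [run_nil]
  | cons a p ih =>
    rw [run_cons, Equiv.Perm.mul_apply]
    have := ih (h.act a x)
    have := h.level_act_le a x
    simp; omega

theorem level_run_origin_le (p : List A) : h.level (h.run p h.origin) ≤ p.length :=
  (h.level_run_le p h.origin).trans_eq (Nat.zero_add _)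

theorem run_eq_of_flipEquiv {p q : List A} (H : FlipEquiv inv Q p q) :
    h.run p.reverse = h.run q.reverse := by
  induction H with
  | nil => rfl
  | cons a _ ih => simp [run_append, ih]
  | @flip a b e e' p q u h1 h2 hq ih1 ih2 =>
    have := h.run_square hq
    simp only [List.reverse_cons, run_append, run_cons, run_nil, one_mul, ih1, ih2, act_inv]
      at this ⊢
    have h3 : h.act a * h.act e' = h.act b * h.act e := by
      rw [mul_assoc, mul_assoc, inv_mul_eq_one, eq_comm, inv_mul_eq_iff_eq_mul] at this
      exact this
    rw [← mul_assoc, h3, mul_assoc]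

/-- At the first arc that fails to ascend, the preceding prefix is equivalent to a word ending with
the inverse of this arc, and the two cancel. -/
theorem exists_shorter_of_not_good {p : List A} (hp : ¬ Good inv Q p.reverse) :
    ∃ q : List A, q.length < p.length ∧ h.run q = h.run p := by
  induction p using List.reverseRecOn with
  | nil => exact (hp trivial).elim
  | append_singleton p a ih =>
    by_cases hg : Good inv Q p.reverse
    · have hd : Desc inv Q p.reverse a := by
        by_contra hd
        exact hp (by simpa using ⟨hg, hd⟩)
      obtain ⟨g, hg⟩ := h.exists_flipEquiv_of_desc hd
      refine ⟨g.reverse, ?_, ?_⟩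
      · have := hg.length_eq
        simp at this ⊢; omega
      · have := h.run_eq_of_flipEquiv hg
        simp only [List.reverse_reverse, List.reverse_cons, run_append, run_cons, run_nil,
          one_mul, act_inv] at this ⊢
        rw [this]; simp
    · obtain ⟨q, h1, h2⟩ := ih hg
      exact ⟨q ++ [a], by simpa using h1, by simp [run_append, h2]⟩

/-- A path is good if and only if it is shortest among the paths with the same action. -/
theorem good_iff_shortest {p : List A} :
    Good inv Q p.reverse ↔ ∀ q, h.run q = h.run p → p.length ≤ q.length := by
  constructor
  · intro hp q hq
    have := h.level_run_origin_le q
    rw [hq, h.run_good hp, level_pt] at this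
    simpa using this
  · intro H
    by_contra hp
    obtain ⟨q, h1, h2⟩ := h.exists_shorter_of_not_good hp
    exact absurd (H q h2) (by omega)

-- Goodness is defined from one end of the word, but being shortest is symmetric under reversal.
include h in
theorem good_inverse {p : List A} (hp : Good inv Q p.reverse) :
    Good inv Q (p.map inv).reverse.reverse := by
  rw [h.good_iff_shortest] at hp ⊢
  intro q hq
  have := hp (q.map inv).reverse (by rw [run_inverse, hq, run_inverse, _root_.inv_inv])
  simpa using this

theorem length_eq_of_run_eq {p q : List A} (hp : Good inv Q p.reverse) (hq : Good inv Q q.reverse)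
    (H : h.run p = h.run q) : p.length = q.length :=
  le_antisymm (h.good_iff_shortest.1 hp q H.symm) (h.good_iff_shortest.1 hq p H)

/-- The first arcs of two good paths with the same action are equal or adjacent. -/
theorem head_eq_or_adj {a b : A} {p q : List A} (hp : Good inv Q (a :: p).reverse)
    (hq : Good inv Q (b :: q).reverse) (H : h.run (a :: p) = h.run (b :: q)) :
    a = b ∨ ∃ c d, Q (inv a) b c d := by
  have h1 := h.good_inverse hp
  have h2 := h.good_inverse hq
  have h3 : h.run ((a :: p).map inv).reverse = h.run ((b :: q).map inv).reverse := by
    rw [run_inverse, run_inverse, H]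
  have h4 := h.run_good h1
  rw [h3, h.run_good h2, pt_eq_pt] at h4
  simp only [List.reverse_reverse, List.map_cons] at h4
  obtain ⟨a', ha⟩ : ∃ a', inv a = a' := ⟨_, rfl⟩
  obtain ⟨b', hb⟩ : ∃ b', inv b = b' := ⟨_, rfl⟩
  rw [ha, hb] at h4
  cases h4 with
  | cons _ _ => exact .inl (by rw [← h.inv_inv a, ha, ← hb, h.inv_inv])
  | flip _ _ hq =>
    refine .inr ?_
    have := h.cyc hq
    rw [← ha, ← hb, h.inv_inv] at this
    exact ⟨_, _, h.adj_symm this⟩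

/-- A good path cannot have the same action as the concatenation of two paths, of the same total
length, that meet in a spur. -/
theorem not_spur_of_good {r p q : List A} {a : A} (hr : Good inv Q r.reverse)
    (hlen : r.length = (p ++ [a]).length + (inv a :: q).length)
    (H : h.run r = h.run (inv a :: q) * h.run (p ++ [a])) : False := by
  have := h.good_iff_shortest.1 hr (p ++ q) (by
    simp [H, run_append, run_cons, run_nil, act_inv, mul_assoc])
  simp at this hlen
  omega

end SquareRelation

/-! ### Systems of quads as square complexes; geodesics are locally shortest -/

namespace CombinatorialSurface

variable {V A : Type*} (S : CombinatorialSurface V A)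

/-- `a b c d` is the boundary, in one direction or the other, of a non-perforated face. -/
def IsSquare (a b c d : A) : Prop :=
  (¬ S.perforated a ∧ b = S.next a ∧ c = S.next b ∧ d = S.next c) ∨
    (¬ S.perforated (S.inv d) ∧ S.inv c = S.next (S.inv d) ∧ S.inv b = S.next (S.inv c) ∧
      S.inv a = S.next (S.inv b))

/-- Clockwise succession of two arcs at a corner of a non-perforated face. -/
def Corner (a b : A) : Prop := b = S.rot a ∧ ¬ S.perforated b

variable {S}

theorem inv_injective : Function.Injective S.inv :=
  Function.LeftInverse.injective S.inv_inv

theorem next_injective : Function.Injective S.next :=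
  S.rot.injective.comp S.inv_injective

theorem corners_one {a b : A} : S.Corners 1 a b ↔ S.Corner a b := by
  simp only [Corners, Corner, pow_one, Nat.lt_one_iff, forall_eq, zero_add]
  constructor <;> rintro ⟨rfl, h⟩ <;> exact ⟨rfl, h⟩

theorem Corner.corners_two {a b c : A} (h1 : S.Corner a b) (h2 : S.Corner b c) :
    S.Corners 2 a c := by
  obtain ⟨rfl, h1⟩ := h1
  obtain ⟨rfl, h2⟩ := h2
  refine ⟨by simp [pow_succ], fun r hr => ?_⟩
  interval_cases r
  · simpa using h1
  · simpa [pow_succ] using h2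

/-- The vertex would be interior, with at most `m` outgoing arcs, against the degree bound. Only `m
≤ 3` is needed below. -/
theorem not_rot_pow_eq_self (hS : S.IsQuadSystem) {x : A} {m : ℕ} (hm : 0 < m) (hm8 : m < 8)
    (hx : (S.rot ^ m) x = x) (hp : ∀ r < m, ¬ S.perforated ((S.rot ^ (r + 1)) x)) : False := by
  have key : ∀ a, S.org a = S.org x → ∃ r < m, a = (S.rot ^ (r + 1)) x := by
    intro a ha
    obtain ⟨z, rfl⟩ := (S.org_eq_iff x a).1 ha.symm
    have hm' : (0 : ℤ) < m := by exact_mod_cast hm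
    obtain ⟨r, hr⟩ := Int.eq_ofNat_of_zero_le (Int.emod_nonneg (z - 1) hm'.ne')
    have hlt := Int.emod_lt_of_pos (z - 1) hm'
    refine ⟨r, by omega, ?_⟩
    have hz : z = ((r + 1 : ℕ) : ℤ) + m * ((z - 1) / m) := by
      have := Int.emod_add_mul_ediv (z - 1) m
      push_cast; omega
    rw [hz, zpow_add, zpow_mul, Equiv.Perm.mul_apply, zpow_natCast, zpow_natCast,
      Equiv.Perm.zpow_apply_eq_self_of_apply_eq_self hx]
  have hint : S.IsInteriorVertex (S.org x) := by
    intro a ha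
    obtain ⟨r, hr, rfl⟩ := key a ha
    exact hp r hr
  have hsub : {a | S.org a = S.org x} ⊆
      (fun r => (S.rot ^ (r + 1)) x) '' (Finset.range m : Set ℕ) := by
    intro a ha
    obtain ⟨r, hr, rfl⟩ := key a ha
    exact ⟨r, by simpa using hr, rfl⟩
  have h1 := hS.2 _ hint
  have h2 := Set.ncard_le_ncard hsub (Set.toFinite _)
  have h3 : ((fun r => (S.rot ^ (r + 1)) x) '' (Finset.range m : Set ℕ)).ncard ≤ m := by
    refine (Set.ncard_image_le (Set.toFinite _)).trans ?_
    simp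
  omega

theorem not_corner_self (hS : S.IsQuadSystem) {x : A} (h : S.Corner x x) : False :=
  not_rot_pow_eq_self hS one_pos (by norm_num) (x := x) (by simpa using h.1.symm) fun r hr => by
    obtain rfl : r = 0 := by omega
    simpa [← h.1] using h.2

theorem not_corner_two (hS : S.IsQuadSystem) {x y : A} (h : S.Corner x y) (h' : S.Corner y x) :
    False := by
  obtain ⟨rfl, h1⟩ := h
  obtain ⟨hx, h2⟩ := h'
  refine not_rot_pow_eq_self hS two_pos (by norm_num) (x := x) hx.symm fun r hr => ?_
  interval_cases r
  · exact h1
  · rw [hx] at h2; exact h2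

theorem not_corner_three (hS : S.IsQuadSystem) {x y z : A} (h : S.Corner x y)
    (h' : S.Corner y z) (h'' : S.Corner z x) : False := by
  obtain ⟨rfl, h1⟩ := h
  obtain ⟨rfl, h2⟩ := h'
  obtain ⟨hx, h3⟩ := h''
  refine not_rot_pow_eq_self hS three_pos (by norm_num) (x := x) hx.symm fun r hr => ?_
  interval_cases r
  · exact h1
  · exact h2
  · rw [hx] at h3; exact h3

theorem perforated_next' (a : A) : S.perforated (S.next a) ↔ S.perforated a := S.perforated_next a

theorem IsSquare.corner {x y c d : A} (h : S.IsSquare (S.inv x) y c d) :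
    (S.Corner x y ∧ S.Corner (S.inv y) c) ∨ (S.Corner y x ∧ S.Corner c (S.inv y)) := by
  rcases h with ⟨hp, rfl, rfl, rfl⟩ | ⟨hp, h1, h2, h3⟩
  · left
    refine ⟨⟨by simp [next, S.inv_inv], by rwa [perforated_next']⟩, ⟨rfl, ?_⟩⟩
    rwa [perforated_next', perforated_next']
  · right
    rw [S.inv_inv] at h3
    have h4 : ¬ S.perforated (S.inv y) := by rwa [h2, perforated_next', h1, perforated_next']
    refine ⟨⟨by rw [h3, next, S.inv_inv], by rwa [h3, perforated_next']⟩, ⟨?_, h4⟩⟩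
    rw [h2, next, S.inv_inv]

theorem next_four (hS : S.IsQuadSystem) {a : A} (h : ¬ S.perforated a) :
    S.next (S.next (S.next (S.next a))) = a := by
  have := Function.iterate_minimalPeriod (f := S.next) (x := a)
  rwa [hS.1 a h] at this

/-- Corners join arcs that follow each other in the rotation, so a loop, a double edge or a triangle
in a link would close up the rotation after one, two or three non-perforated corners. -/
theorem squareRelation (hS : S.IsQuadSystem) : SquareRelation S.inv S.IsSquare where
  inv_inv := S.inv_inv
  cyc := by
    rintro a b c d (⟨hp, rfl, rfl, rfl⟩ | ⟨hp, h1, h2, h3⟩)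
    · left
      exact ⟨by rwa [perforated_next'], rfl, rfl, (next_four hS hp).symm⟩
    · right
      refine ⟨?_, ?_, h1, h2⟩
      · rwa [h3, perforated_next', h2, perforated_next', h1, perforated_next']
      · rw [h3, h2, h1, next_four hS hp]
  rev := by
    rintro a b c d (⟨hp, h1, h2, h3⟩ | ⟨hp, h1, h2, h3⟩)
    · right
      simpa only [S.inv_inv] using ⟨hp, h1, h2, h3⟩
    · left
      exact ⟨hp, h1, h2, h3⟩
  det := by
    -- Two squares of opposite orientations on the same arcs `a`, `b` would occupy both corners
    -- between `inv a` and `b`, giving a vertex of degree two.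
    have key : ∀ {a b c d : A}, ¬ S.perforated a → b = S.next a →
        ¬ S.perforated (S.inv d) → S.inv c = S.next (S.inv d) → S.inv b = S.next (S.inv c) →
        S.inv a = S.next (S.inv b) → False := by
      intro a b c d hp h0 hp' h1 h2 h3
      refine not_corner_two hS (x := S.inv a) (y := b) ⟨h0, by rwa [h0, perforated_next']⟩
        ⟨by rw [h3, next, S.inv_inv], ?_⟩
      rwa [h3, perforated_next', h2, perforated_next', h1, perforated_next']
    rintro a b c d c' d' (⟨hp, rfl, rfl, rfl⟩ | ⟨hp, h1, h2, h3⟩) (⟨hp', h0, rfl, rfl⟩ |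
      ⟨hp', h1', h2', h3'⟩)
    · exact ⟨rfl, rfl⟩
    · exact (key hp rfl hp' h1' h2' h3').elim
    · exact (key hp' h0 hp h1 h2 h3).elim
    · have hc : c = c' := S.inv_injective (next_injective (h2.symm.trans h2'))
      subst hc
      exact ⟨rfl, S.inv_injective (next_injective (h1.symm.trans h1'))⟩
  noLoop := by
    intro a c d h
    rw [← S.inv_inv a, S.inv_inv (S.inv a)] at h
    rcases h.corner with ⟨k, -⟩ | ⟨k, -⟩ <;> exact not_corner_self hS k
  noTriangle := by
    intro x y z c d c' d' c'' d'' h1 h2 h3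
    rcases h1.corner with ⟨k1, -⟩ | ⟨k1, -⟩ <;> rcases h2.corner with ⟨k2, -⟩ | ⟨k2, -⟩ <;>
      rcases h3.corner with ⟨k3, -⟩ | ⟨k3, -⟩
    · have : z = y := k3.1.trans k1.1.symm
      exact not_corner_self hS (this ▸ k2)
    · exact not_corner_three hS k1 k2 k3
    · have : x = z := S.rot.injective (k1.1.symm.trans k2.1)
      exact not_corner_self hS (this ▸ k3)
    · have : x = z := S.rot.injective (k1.1.symm.trans k2.1)
      exact not_corner_self hS (this ▸ k3)
    · have : x = z := k1.1.trans k2.1.symm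
      exact not_corner_self hS (this ▸ k3)
    · have : x = z := k1.1.trans k2.1.symm
      exact not_corner_self hS (this ▸ k3)
    · exact not_corner_three hS k3 k2 k1
    · have : z = y := S.rot.injective (k3.1.symm.trans k1.1)
      exact not_corner_self hS (this ▸ k2)

/-! ### Homotopy and the action on the universal cover -/

theorem run_eq_of_elementaryStep (hS : S.IsQuadSystem) {p q : List A}
    (h : S.ElementaryStep p q) : (squareRelation hS).run p = (squareRelation hS).run q := by
  cases h with
  | spur u w a =>
    simp [SquareRelation.run_append, SquareRelation.run_cons,
      SquareRelation.act_inv]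
  | face u w a ha =>
    have hf : S.facialWalk a =
        [a, S.next a, S.next (S.next a), S.next (S.next (S.next a))] := by
      simp [facialWalk, hS.1 a ha, List.range_succ]
    have hq : S.IsSquare a (S.next a) (S.next (S.next a)) (S.next (S.next (S.next a))) :=
      .inl ⟨ha, rfl, rfl, rfl⟩
    rw [SquareRelation.run_append, SquareRelation.run_append, SquareRelation.run_append, hf,
      (squareRelation hS).run_square hq, mul_one]

theorem PathHomotopic.run_eq (hS : S.IsQuadSystem) {v w : V} {p q : List A}
    (h : S.PathHomotopic v w p q) : (squareRelation hS).run p = (squareRelation hS).run q := by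
  induction h with
  | rel _ _ h => exact run_eq_of_elementaryStep hS h.2.2
  | refl => rfl
  | symm _ _ _ ih => exact ih.symm
  | trans _ _ _ _ _ ih1 ih2 => exact ih1.trans ih2

/-! ### Subpaths of geodesics -/

variable {n : ℕ}

/-- The subpath of length `m` of `c` starting at `i`. -/
def forwardPath (c : ZMod n → A) (i : ZMod n) (m : ℕ) : List A :=
  (List.range m).map fun p : ℕ => c (i + p)

theorem forwardPath_length (c : ZMod n → A) (i : ZMod n) (m : ℕ) :
    (forwardPath c i m).length = m := by simp [forwardPath]

theorem forwardPath_succ (c : ZMod n → A) (i : ZMod n) (m : ℕ) :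
    forwardPath c i (m + 1) = forwardPath c i m ++ [c (i + m)] := by
  simp [forwardPath, List.range_succ]

theorem forwardPath_add (c : ZMod n → A) (i : ZMod n) (m m' : ℕ) :
    forwardPath c i (m + m') = forwardPath c i m ++ forwardPath c (i + m) m' := by
  induction m' with
  | zero => simp [forwardPath]
  | succ k ih =>
    rw [← add_assoc, forwardPath_succ, ih, forwardPath_succ, List.append_assoc]
    push_cast; rw [add_assoc]

theorem forwardPath_succ' (c : ZMod n → A) (i : ZMod n) (m : ℕ) :
    forwardPath c i (m + 1) = c i :: forwardPath c (i + 1) m := by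
  rw [add_comm, forwardPath_add]
  simp [forwardPath]

theorem imagePath_natCast (c : ZMod n → A) (i : ZMod n) (m : ℕ) :
    S.imagePath c i m = forwardPath c i m := by
  rw [imagePath, forwardPath, Int.natAbs_natCast]
  refine List.map_congr_left fun p hp => ?_
  have : 0 < (m : ℤ) := by have := List.mem_range.1 hp; omega
  simp only [pathArc, pathIndex, this, if_true]

theorem imagePath_neg (c : ZMod n → A) (j : ZMod n) (m : ℕ) :
    S.imagePath c j (-(m : ℤ)) = ((forwardPath c (j - m) m).map S.inv).reverse := by
  refine List.ext_getElem (by simp [imagePath, forwardPath]) fun p hp _ => ?_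
  have hp' : p < m := by simpa [imagePath] using hp
  have h0 : ¬ (m : ℤ) < 0 := by omega
  simp only [imagePath, forwardPath, pathArc, pathIndex, List.getElem_map, List.getElem_range,
    List.getElem_reverse, List.length_map, List.length_range, Left.neg_pos_iff, h0, if_false]
  congr 2
  have : ((m - 1 - p : ℕ) : ZMod n) = m - 1 - p := by
    rw [Nat.cast_sub (by omega), Nat.cast_sub (by omega)]; simp
  rw [this]; ring

/-- The turns of `c` from the index `t` on read `1 2 ⋯ 2` (`j` turns). -/
def PosRun (S : CombinatorialSurface V A) (c : ZMod n → A) (t : ZMod n) (j : ℕ) : Prop :=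
  S.TurnPos 1 (c t) (c (t + 1)) ∧
    ∀ r : ℕ, 1 ≤ r → r < j → S.TurnPos 2 (c (t + r)) (c (t + r + 1))

/-- The turns of `c` from the index `t` on read `-1 -2 ⋯ -2` (`j` turns). -/
def NegRun (S : CombinatorialSurface V A) (c : ZMod n → A) (t : ZMod n) (j : ℕ) : Prop :=
  S.TurnNeg 1 (c t) (c (t + 1)) ∧
    ∀ r : ℕ, 1 ≤ r → r < j → S.TurnNeg 2 (c (t + r)) (c (t + r + 1))

/-- A descending arc that is not a backtrack is the far side of a strip of squares lying along the
end of the path. At an intermediate vertex of the strip two squares meet, hence a turn `2`; its two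
end corners are turns `1`. Up to sign, this is a bracket lacking only its last turn, towards `d`. -/
theorem desc_forwardPath {c : ZMod n → A} (hsp : ¬ S.HasSpur c) (i : ZMod n) (m : ℕ) {d : A}
    (h : SquareRelation.Desc S.inv S.IsSquare (forwardPath c i (m + 1)).reverse d) :
    d = S.inv (c (i + m)) ∨ ∃ (t : ZMod n) (j : ℕ), 1 ≤ j ∧ j ≤ m ∧ t + j = i + m ∧
      ((S.PosRun c t j ∧ S.TurnPos 1 (c (t + j)) d) ∨
        (S.NegRun c t j ∧ S.TurnNeg 1 (c (t + j)) d)) := by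
  induction m generalizing d with
  | zero =>
    left
    simpa [forwardPath, SquareRelation.Desc] using h
  | succ m ih =>
    rw [forwardPath_succ, List.reverse_append] at h
    rcases h with rfl | ⟨e, f, he, hq⟩
    · exact .inl rfl
    have hs : ∀ t : ZMod n, t = i + m → t + 1 = i + ((m + 1 : ℕ) : ZMod n) := by
      rintro t rfl; push_cast; ring
    have hspur : c (i + ((m + 1 : ℕ) : ZMod n)) ≠ S.inv (c (i + m)) := fun h =>
      hsp ⟨i + m, by rw [hs _ rfl, h]⟩
    set b := c (i + ((m + 1 : ℕ) : ZMod n)) with hb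
    right
    -- If the new square lies on the other side from the earlier strip, its corner undoes the corner
    -- before `e` and the path has a spur. If it lies on the same side, the two corners add up to a
    -- turn `2`.
    rcases hq.corner with ⟨k1, k2⟩ | ⟨k1, k2⟩ <;>
      rcases ih he with rfl | ⟨t, j, hj, hjm, ht, ⟨⟨r1, r2⟩, r3⟩ | ⟨⟨r1, r2⟩, r3⟩⟩
    · refine ⟨i + m, 1, le_rfl, by omega, ?_, .inl ⟨⟨?_, fun r h1 h2 => by omega⟩, ?_⟩⟩
      · rw [Nat.cast_one, hs _ rfl]
      · rw [hs _ rfl]; exact corners_one.2 k1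
      · rw [Nat.cast_one, hs _ rfl]; exact corners_one.2 k2
    · have ht' : t + ((j + 1 : ℕ) : ZMod n) = i + ((m + 1 : ℕ) : ZMod n) := by
        rw [← hs _ ht]; push_cast; ring
      refine ⟨t, j + 1, by omega, by omega, ht', .inl ⟨⟨r1, fun r h1 h2 => ?_⟩, ?_⟩⟩
      · rcases Nat.lt_succ_iff_lt_or_eq.1 h2 with h2 | rfl
        · exact r2 r h1 h2
        · rw [hs _ ht]
          exact (corners_one.1 r3).corners_two k1
      · rw [ht']; exact corners_one.2 k2
    · refine (hspur ?_).elim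
      rw [← ht, (corners_one.1 r3).1]; exact k1.1
    · refine ⟨i + m, 1, le_rfl, by omega, ?_, .inr ⟨⟨?_, fun r h1 h2 => by omega⟩, ?_⟩⟩
      · rw [Nat.cast_one, hs _ rfl]
      · rw [hs _ rfl]; exact corners_one.2 k1
      · rw [Nat.cast_one, hs _ rfl]; exact corners_one.2 k2
    · refine (hspur ?_).elim
      rw [← ht]
      exact S.rot.injective (k1.1.symm.trans (corners_one.1 r3).1)
    · have ht' : t + ((j + 1 : ℕ) : ZMod n) = i + ((m + 1 : ℕ) : ZMod n) := by
        rw [← hs _ ht]; push_cast; ring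
      refine ⟨t, j + 1, by omega, by omega, ht', .inr ⟨⟨r1, fun r h1 h2 => ?_⟩, ?_⟩⟩
      · rcases Nat.lt_succ_iff_lt_or_eq.1 h2 with h2 | rfl
        · exact r2 r h1 h2
        · rw [hs _ ht]
          exact k1.corners_two (corners_one.1 r3)
      · rw [ht']; exact corners_one.2 k2

/-- The subpaths of length at most `n` of a geodesic are good. -/
theorem good_forwardPath {c : ZMod n → A} (hgeo : S.IsGeodesic c) (i : ZMod n) (m : ℕ)
    (hm : m ≤ n) : SquareRelation.Good S.inv S.IsSquare (forwardPath c i m).reverse := by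
  induction m with
  | zero => trivial
  | succ m ih =>
    rw [forwardPath_succ, List.reverse_append]
    refine ⟨ih (by omega), fun hd => ?_⟩
    rcases m with _ | m
    · simp [forwardPath, SquareRelation.Desc] at hd
    have hs : ∀ t : ZMod n, t = i + m → t + 1 = i + ((m + 1 : ℕ) : ZMod n) := by
      rintro t rfl; push_cast; ring
    rcases desc_forwardPath hgeo.1 i m hd with h | ⟨t, j, hj, hjm, ht, h⟩
    · exact hgeo.1 ⟨i + m, by rw [hs _ rfl, h]⟩
    · refine hgeo.2 ⟨t, j, hj, by omega, ?_⟩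
      rw [hs _ ht]
      rcases h with ⟨h1, h2⟩ | ⟨h1, h2⟩
      · exact .inl ⟨h1.1, h1.2, h2⟩
      · exact .inr ⟨h1.1, h1.2, h2⟩

theorem good_imagePath (hS : S.IsQuadSystem) {c : ZMod n → A} (hgeo : S.IsGeodesic c)
    (i : ZMod n) (k : ℤ) (hk : k.natAbs ≤ n) :
    SquareRelation.Good S.inv S.IsSquare (S.imagePath c i k).reverse := by
  rcases Int.natAbs_eq k with h | h
  · rw [h, imagePath_natCast]
    exact good_forwardPath hgeo i _ hk
  · rw [h, imagePath_neg]
    exact (squareRelation hS).good_inverse (good_forwardPath hgeo _ _ hk)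

theorem imagePath_length (c : ZMod n → A) (i : ZMod n) (k : ℤ) :
    (S.imagePath c i k).length = k.natAbs := by simp [imagePath]

/-- Homotopic subpaths of a geodesic have the same length. -/
theorem natAbs_eq_of_homotopic (hS : S.IsQuadSystem) {c : ZMod n → A} (hgeo : S.IsGeodesic c)
    {i j : ZMod n} {k l : ℤ} (hk : k.natAbs ≤ n) (hl : l.natAbs ≤ n) {v w : V}
    (h : S.PathHomotopic v w (S.imagePath c i k) (S.imagePath c j l)) : k.natAbs = l.natAbs := by
  have := (squareRelation hS).length_eq_of_run_eq (good_imagePath hS hgeo i k hk)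
    (good_imagePath hS hgeo j l hl) (h.run_eq hS)
  simpa [imagePath_length] using this

/-- Local picture at the vertex common to the tips of two consecutive homotopic subpaths, from `i`
to `j` and from `j` to `m`, of a geodesic. -/
theorem arcs_of_consecutive_homotopic (hS : S.IsQuadSystem) {c : ZMod n → A}
    (hgeo : S.IsGeodesic c) {i j m : ZMod n} {ℓ : ℕ} (hℓ : 0 < ℓ) (hn : ℓ + ℓ ≤ n)
    (hj : j = i + ℓ) (hm : m = j + ℓ)
    (h : (squareRelation hS).run (forwardPath c i ℓ) =
      (squareRelation hS).run (forwardPath c j ℓ)) :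
    (c i = c j ∨ S.rot (c i) = c j ∨ S.rot (c j) = c i) ∧
      S.inv (c (j - 1)) ≠ c i ∧ S.inv (c (j - 1)) ≠ c j ∧
      S.inv (c (m - 1)) ≠ c i ∧ S.inv (c (m - 1)) ≠ c j := by
  set R := squareRelation hS
  obtain ⟨l, rfl⟩ : ∃ l, ℓ = l + 1 := ⟨ℓ - 1, by omega⟩
  have good2 := good_forwardPath hgeo i (l + 1 + (l + 1)) hn
  have run2 : R.run (forwardPath c i (l + 1 + (l + 1))) =
      R.run (forwardPath c j (l + 1)) * R.run (forwardPath c i (l + 1)) := by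
    rw [forwardPath_add, SquareRelation.run_append, hj]
  -- Both sides have the same action, so any copy of one may replace either half of the good path of
  -- length `2ℓ`. A coincidence of arcs would then put a spur in the middle.
  have key : ∀ s t : ZMod n, R.run (forwardPath c s (l + 1)) = R.run (forwardPath c j (l + 1)) →
      R.run (forwardPath c t (l + 1)) = R.run (forwardPath c j (l + 1)) →
      S.inv (c (s + l)) ≠ c t := by
    intro s t hs ht hst
    refine R.not_spur_of_good good2 (p := forwardPath c s l) (a := c (s + l))
      (q := forwardPath c (t + 1) l) ?_ ?_
    · simp [forwardPath_length]
    · rw [run2, hst, ← forwardPath_succ, ← forwardPath_succ', hs, ht, h]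
  have e1 : j - 1 = i + l := by rw [hj]; push_cast; ring
  have e2 : m - 1 = j + l := by rw [hm]; push_cast; ring
  rw [e1, e2]
  refine ⟨?_, key _ _ h h, key _ _ h rfl, key _ _ rfl h, key _ _ rfl rfl⟩
  have g1 := good_forwardPath hgeo i (l + 1) (by omega)
  have g2 := good_forwardPath hgeo j (l + 1) (by omega)
  rw [forwardPath_succ'] at g1 g2
  rcases R.head_eq_or_adj g1 g2 (by rw [← forwardPath_succ', ← forwardPath_succ', h]) with
    h | ⟨a, b, h⟩
  · exact .inl h
  · rcases h.corner with ⟨h, -⟩ | ⟨h, -⟩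
    · exact .inr (.inl h.1.symm)
    · exact .inr (.inr h.1.symm)

end CombinatorialSurface

/-! ### Circular orders of darts and interleaved chords -/

namespace CombinatorialSurface

variable {V A : Type*} {S : CombinatorialSurface V A}

/-! ### Circular orders -/

theorem exists_rot_pow [Finite A] {a b : A} (h : S.org b = S.org a) :
    ∃ m < Function.minimalPeriod S.rot a, (S.rot ^ m) a = b := by
  obtain ⟨z, hz⟩ := (S.org_eq_iff a b).1 h.symm
  have hper : a ∈ Function.periodicPts S.rot :=
    Function.Injective.mem_periodicPts S.rot.injective a
  have hd := Function.minimalPeriod_pos_of_mem_periodicPts hper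
  have hfix : (S.rot ^ Function.minimalPeriod S.rot a) a = a := by
    rw [← Equiv.Perm.iterate_eq_pow]; exact Function.iterate_minimalPeriod
  set d := Function.minimalPeriod S.rot a
  have hd' : (0 : ℤ) < d := by exact_mod_cast hd
  obtain ⟨r, hr⟩ := Int.eq_ofNat_of_zero_le (Int.emod_nonneg z hd'.ne')
  have hlt := Int.emod_lt_of_pos z hd'
  refine ⟨r, by omega, ?_⟩
  have hz' : z = (r : ℤ) + d * (z / d) := by
    have := Int.emod_add_mul_ediv z d
    omega
  rw [← hz, hz', zpow_add, zpow_mul, Equiv.Perm.mul_apply, zpow_natCast, zpow_natCast,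
    Equiv.Perm.zpow_apply_eq_self_of_apply_eq_self hfix]

theorem rank_eq {a b : A} {m : ℕ} (hm : m < Function.minimalPeriod S.rot a)
    (h : (S.rot ^ m) a = b) : S.rank a b = m := by
  have hmem : m ∈ {m : ℕ | (S.rot ^ m) a = b} := h
  have h1 : (S.rot ^ S.rank a b) a = b := Nat.sInf_mem ⟨m, hmem⟩
  have h2 : S.rank a b ≤ m := Nat.sInf_le hmem
  refine Function.iterate_injOn_Iio_minimalPeriod (f := S.rot) (x := a)
    (Set.mem_Iio.2 (h2.trans_lt hm)) (Set.mem_Iio.2 hm) ?_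
  simp only [Equiv.Perm.iterate_eq_pow]
  rw [h1, h]

theorem rank_spec [Finite A] {a b : A} (h : S.org b = S.org a) :
    S.rank a b < Function.minimalPeriod S.rot a ∧ (S.rot ^ S.rank a b) a = b := by
  obtain ⟨m, hm, hb⟩ := exists_rot_pow h
  rw [rank_eq hm hb]
  exact ⟨hm, hb⟩

theorem rank_injOn [Finite A] {a b b' : A} (hb : S.org b = S.org a) (hb' : S.org b' = S.org a)
    (h : S.rank a b = S.rank a b') : b = b' := by
  rw [← (rank_spec hb).2, ← (rank_spec hb').2, h]

/-- Going clockwise from `a` to `b` through `a'` overshoots by exactly one full turn when `b` comes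
before `a'`, and not at all otherwise. -/
theorem rank_change_base [Finite A] {a a' b : A} (ha : S.org a' = S.org a)
    (hb : S.org b = S.org a) :
    S.rank a b + (if S.rank a b < S.rank a a' then Function.minimalPeriod S.rot a else 0) =
      S.rank a a' + S.rank a' b := by
  obtain ⟨h1, h2⟩ := rank_spec ha
  obtain ⟨h3, h4⟩ := rank_spec (hb.trans ha.symm)
  have hper : Function.minimalPeriod S.rot a' = Function.minimalPeriod S.rot a := by
    have := Function.minimalPeriod_apply_iterate
      (Function.Injective.mem_periodicPts S.rot.injective a) (S.rank a a')
    rwa [Equiv.Perm.iterate_eq_pow, h2] at this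
  rw [hper] at h3
  have hfix : (S.rot ^ Function.minimalPeriod S.rot a) a = a := by
    rw [← Equiv.Perm.iterate_eq_pow]; exact Function.iterate_minimalPeriod
  have h5 : (S.rot ^ (S.rank a' b + S.rank a a')) a = b := by
    rw [pow_add, Equiv.Perm.mul_apply, h2, h4]
  by_cases hlt : S.rank a a' + S.rank a' b < Function.minimalPeriod S.rot a
  · rw [rank_eq (by omega) h5]
    simp only [add_lt_iff_neg_right, not_lt_zero, if_false]
    omega
  · have h6 : (S.rot ^ (S.rank a' b + S.rank a a' - Function.minimalPeriod S.rot a)) a = b := by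
      have e : S.rank a' b + S.rank a a' =
        S.rank a' b + S.rank a a' - Function.minimalPeriod S.rot a +
          Function.minimalPeriod S.rot a := by omega
      rwa [e, pow_add, Equiv.Perm.mul_apply, hfix] at h5
    rw [rank_eq (by omega) h6, if_pos (by omega)]
    omega

variable {n : ℕ} {c : ZMod n → A} {left : A → ZMod n → ZMod n → Prop}

theorem exists_append_of_pairwise {α : Type*} {r : α → α → Prop} {P : α → Prop} {L : List α}
    (hL : L.Pairwise r) (hP : ∀ x ∈ L, ∀ y ∈ L, r x y → P y → P x) :
    ∃ L1 L2, L = L1 ++ L2 ∧ (∀ x ∈ L1, P x) ∧ ∀ x ∈ L2, ¬ P x := by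
  induction L with
  | nil => exact ⟨[], [], by simp⟩
  | cons x L ih =>
    rw [List.pairwise_cons] at hL
    by_cases hx : P x
    · obtain ⟨L1, L2, rfl, h1, h2⟩ := ih hL.2 fun y hy z hz =>
        hP y (List.mem_cons_of_mem _ hy) z (List.mem_cons_of_mem _ hz)
      exact ⟨x :: L1, L2, by simp, by simpa using ⟨hx, h1⟩, h2⟩
    · refine ⟨[], x :: L, by simp, by simp, fun y hy hPy => hx ?_⟩
      rcases List.mem_cons.1 hy with rfl | hy'
      · exact hPy
      · exact hP x (by simp) y hy (hL.1 y hy') hPy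

/-- A list sorted from `a'` consists of the darts from `a'` up to the end of the turn started at
`a`, then of those before `a'`. Exchanging these blocks sorts it from `a`. -/
theorem pairwise_before_change_base [Finite A] {a a' : A} (ha : S.org a' = S.org a)
    {L : List (ZMod n × Bool)} (hL : ∀ x ∈ L, S.org (S.dartArc c x) = S.org a)
    (h : L.Pairwise (S.Before c left a')) :
    ∃ r : ℕ, (L.rotate r).Pairwise (S.Before c left a) := by
  obtain ⟨L1, L2, rfl, h1, h2⟩ := exists_append_of_pairwise
    (P := fun x => S.rank a a' ≤ S.rank a (S.dartArc c x)) h (by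
      intro x hx y hy hxy hPy
      have h1 := rank_change_base ha (hL x hx)
      have h2 := rank_change_base ha (hL y hy)
      have h3 := (rank_spec (hL y hy)).1
      rcases hxy with h | ⟨h, -⟩
      · by_contra hlt
        rw [if_neg (by omega)] at h2
        rw [if_pos (by omega)] at h1
        omega
      · rwa [h])
  refine ⟨L1.length, ?_⟩
  rw [List.rotate_append_length_eq]
  have hL1 : ∀ x ∈ L1, S.org (S.dartArc c x) = S.org a := fun x hx =>
    hL x (List.mem_append_left _ hx)
  have hL2 : ∀ x ∈ L2, S.org (S.dartArc c x) = S.org a := fun x hx =>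
    hL x (List.mem_append_right _ hx)
  rw [List.pairwise_append] at h ⊢
  refine ⟨h.2.1.imp_of_mem fun {x y} hx hy hxy => ?_,
    h.1.imp_of_mem fun {x y} hx hy hxy => ?_, fun x hx y hy => ?_⟩
  · have e1 := rank_change_base ha (hL2 x hx)
    have e2 := rank_change_base ha (hL2 y hy)
    have := h2 x hx
    have := h2 y hy
    rw [if_pos (by omega)] at e1 e2
    rcases hxy with h | h
    · left; omega
    · exact .inr h
  · have e1 := rank_change_base ha (hL1 x hx)
    have e2 := rank_change_base ha (hL1 y hy)
    have := h1 x hx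
    have := h1 y hy
    rw [if_neg (by omega)] at e1 e2
    rcases hxy with h | h
    · left; omega
    · exact .inr h
  · left
    have := h2 x hx
    have := h1 y hy
    omega

theorem inCircularOrder_iff [Finite A] (a : A) {L : List (ZMod n × Bool)}
    (hL : ∀ x ∈ L, S.org (S.dartArc c x) = S.org a) :
    S.InCircularOrder c left L ↔ ∃ r : ℕ, (L.rotate r).Pairwise (S.Before c left a) := by
  constructor
  · rintro ⟨a', ha', r, hr⟩
    rcases L with _ | ⟨x, L⟩
    · exact ⟨0, by simp⟩
    obtain ⟨r', hr'⟩ := pairwise_before_change_base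
      ((ha' x (by simp)).symm.trans (hL x (by simp)))
      (fun y hy => hL y (List.mem_rotate.1 hy)) hr
    exact ⟨r + r', by rwa [← List.rotate_rotate]⟩
  · exact fun h => ⟨a, hL, h⟩

theorem occurs_dartArc (x : ZMod n × Bool) : S.Occurs c (S.dartArc c x) x.1 := by
  rcases x with ⟨t, b⟩
  cases b <;> simp [Occurs, dartArc, S.inv_inv]

variable [Finite A]

omit [Finite A] in
theorem Before.irrefl (hI : S.IsImmersion c left) (a : A) (x : ZMod n × Bool) :
    ¬ S.Before c left a x x := by
  rintro (h | ⟨-, h⟩)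
  · exact lt_irrefl _ h
  · exact hI.irrefl _ _ (occurs_dartArc x) h

omit [Finite A] in
theorem Before.trans (hI : S.IsImmersion c left) {a : A} {x y z : ZMod n × Bool}
    (h1 : S.Before c left a x y) (h2 : S.Before c left a y z) : S.Before c left a x z := by
  rcases h1 with h1 | ⟨e1, h1⟩ <;> rcases h2 with h2 | ⟨e2, h2⟩
  · exact .inl (h1.trans h2)
  · exact .inl (e2 ▸ h1)
  · exact .inl (e1 ▸ h2)
  · refine .inr ⟨e1.trans e2, hI.trans _ _ y.1 _ (occurs_dartArc x) ?_ ?_ h1 (e1 ▸ h2)⟩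
    · rw [e1]; exact occurs_dartArc y
    · rw [e1, e2]; exact occurs_dartArc z

theorem Before.total (hI : S.IsImmersion c left) {a : A} {x y : ZMod n × Bool}
    (hx : S.org (S.dartArc c x) = S.org a) (hy : S.org (S.dartArc c y) = S.org a) (hxy : x ≠ y) :
    S.Before c left a x y ∨ S.Before c left a y x := by
  rcases lt_trichotomy (S.rank a (S.dartArc c x)) (S.rank a (S.dartArc c y)) with h | h | h
  · exact .inl (.inl h)
  · have e := rank_injOn hx hy h
    -- Opposite darts of one occurrence never lie on the same arc, since an arc differs from its
    -- inverse.
    have hne : x.1 ≠ y.1 := by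
      intro h1
      rcases x with ⟨t, b⟩
      rcases y with ⟨t', b'⟩
      dsimp only at h1
      subst h1
      cases b <;> cases b' <;> simp [dartArc] at hxy e
      · exact S.inv_ne _ e
      · exact S.inv_ne _ e.symm
    rcases hI.total _ _ _ (occurs_dartArc x) (e ▸ occurs_dartArc y) hne with h | h
    · exact .inl (.inr ⟨e, h⟩)
    · exact .inr (.inr ⟨e.symm, e ▸ h⟩)
  · exact .inr (.inl h)

/-- Position of a dart in the linear order at the origin of `a`, starting with `a`. -/
noncomputable def pos (S : CombinatorialSurface V A) (c : ZMod n → A)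
    (left : A → ZMod n → ZMod n → Prop) (a : A) (x : ZMod n × Bool) : ℕ :=
  {y | S.org (S.dartArc c y) = S.org a ∧ S.Before c left a y x}.ncard

variable [NeZero n]

omit [Finite A] in
theorem pos_lt_of_before (hI : S.IsImmersion c left) {a : A} {x y : ZMod n × Bool}
    (hx : S.org (S.dartArc c x) = S.org a) (h : S.Before c left a x y) :
    S.pos c left a x < S.pos c left a y := by
  refine Set.ncard_lt_ncard (Set.ssubset_iff_of_subset ?_ |>.2 ⟨x, ⟨hx, h⟩, ?_⟩)
    (Set.toFinite _)
  · exact fun z hz => ⟨hz.1, hz.2.trans hI h⟩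
  · exact fun hz => Before.irrefl hI a x hz.2

theorem before_iff (hI : S.IsImmersion c left) {a : A} {x y : ZMod n × Bool}
    (hx : S.org (S.dartArc c x) = S.org a) (hy : S.org (S.dartArc c y) = S.org a) :
    S.Before c left a x y ↔ S.pos c left a x < S.pos c left a y := by
  refine ⟨pos_lt_of_before hI hx, fun h => ?_⟩
  have hne : x ≠ y := by rintro rfl; exact lt_irrefl _ h
  rcases Before.total hI hx hy hne with h' | h'
  · exact h'
  · exact absurd (pos_lt_of_before hI hy h') h.not_gt

theorem pos_injOn (hI : S.IsImmersion c left) {a : A} {x y : ZMod n × Bool}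
    (hx : S.org (S.dartArc c x) = S.org a) (hy : S.org (S.dartArc c y) = S.org a)
    (h : S.pos c left a x = S.pos c left a y) : x = y := by
  by_contra hne
  rcases Before.total hI hx hy hne with h' | h'
  · exact absurd (pos_lt_of_before hI hx h') (by omega)
  · exact absurd (pos_lt_of_before hI hy h') (by omega)

/-- Turns circular order into inequalities between natural numbers; bounding the rotation leaves
finitely many cases. -/
theorem inCircularOrder_iff_pos (hI : S.IsImmersion c left) (a : A) {L : List (ZMod n × Bool)}
    (hL : ∀ x ∈ L, S.org (S.dartArc c x) = S.org a) :
    S.InCircularOrder c left L ↔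
      ∃ r < L.length + 1, ((L.map (S.pos c left a)).rotate r).Pairwise (· < ·) := by
  rw [inCircularOrder_iff a hL]
  have key : ∀ r, (L.rotate r).Pairwise (S.Before c left a) ↔
      ((L.map (S.pos c left a)).rotate r).Pairwise (· < ·) := by
    intro r
    rw [← List.map_rotate, List.pairwise_map]
    refine List.Pairwise.iff_of_mem fun {x y} hx hy => ?_
    exact before_iff hI (hL x (List.mem_rotate.1 hx)) (hL y (List.mem_rotate.1 hy))
  simp only [key]
  constructor
  · rintro ⟨r, hr⟩
    rcases Nat.eq_zero_or_pos L.length with h | h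
    · exact ⟨0, by omega, by simp [List.length_eq_zero_iff.1 h]⟩
    refine ⟨r % L.length, ?_, ?_⟩
    · have := Nat.mod_lt r h; omega
    · have := List.rotate_mod (L.map (S.pos c left a)) r
      rw [List.length_map] at this
      rwa [this]
  · rintro ⟨r, -, hr⟩
    exact ⟨r, hr⟩

/-- The pairs `a, b` and `c, d` of numbers separate each other. -/
def Separate (a b c d : ℕ) : Prop :=
  (min a b < c ∧ c < max a b ∧ (d < min a b ∨ max a b < d)) ∨
    (min a b < d ∧ d < max a b ∧ (c < min a b ∨ max a b < c))

/-- Each equivalence on the right says that an endpoint is not between `p` and `p'`; separation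
means that exactly one of `a`, `b` is between them. -/
theorem separate_iff {a b p p' : ℕ} (h1 : p ≠ a) (h2 : p ≠ b) (h3 : p' ≠ a) (h4 : p' ≠ b) :
    Separate a b p p' ↔ ((a < p ↔ a < p') ↔ ¬ (b < p ↔ b < p')) := by
  unfold Separate
  omega

theorem Separate.cyclic {p p' q q' : ℕ} (h : Separate p p' q q') :
    (p < q ∧ q < p' ∧ p' < q') ∨ (q < p' ∧ p' < q' ∧ q' < p) ∨
      (p' < q' ∧ q' < p ∧ p < q) ∨ (q' < p ∧ p < q ∧ q < p') ∨
      (q' < p' ∧ p' < q ∧ q < p) ∨ (p' < q ∧ q < p ∧ p < q') ∨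
      (q < p ∧ p < q' ∧ q' < p') ∨ (p < q' ∧ q' < p' ∧ p' < q) := by
  unfold Separate at h
  rcases le_total p p' with hp | hp
  · rw [min_eq_left hp, max_eq_right hp] at h
    rcases h with ⟨h1, h2, h3 | h3⟩ | ⟨h1, h2, h3 | h3⟩ <;> simp [*]
  · rw [min_eq_right hp, max_eq_left hp] at h
    rcases h with ⟨h1, h2, h3 | h3⟩ | ⟨h1, h2, h3 | h3⟩ <;> simp [*]

/-- The chord `p p'` cannot have both ends of one of two crossing chords on one side and both ends
of the other on the other side. This is the only configuration in which uncrossing would create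
crossings. -/
theorem Separate.not_separate {a a' b b' p p' : ℕ} (h : Separate a a' b b')
    (h1 : p ≠ a) (h2 : p ≠ a') (h3 : p ≠ b) (h4 : p ≠ b')
    (h5 : p' ≠ a) (h6 : p' ≠ a') (h7 : p' ≠ b) (h8 : p' ≠ b') :
    ¬ (((a < p ↔ a < p') ↔ (a' < p ↔ a' < p')) ∧ ((b < p ↔ b < p') ↔ (b' < p ↔ b' < p')) ∧
      ((a < p ↔ a < p') ↔ ¬ (b < p ↔ b < p'))) := by
  unfold Separate at h
  omega

/-- The pairs `x, x'` and `y, y'` of darts separate each other in the circular order. -/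
def Interleave (S : CombinatorialSurface V A) (c : ZMod n → A)
    (left : A → ZMod n → ZMod n → Prop) (x x' y y' : ZMod n × Bool) : Prop :=
  S.InCircularOrderOrOpposite c left [x, y, x', y']

omit [Finite A] [NeZero n] in
theorem Interleave.org_eq {x x' y y' : ZMod n × Bool} (h : S.Interleave c left x x' y y') :
    S.org (S.dartArc c x') = S.org (S.dartArc c x) ∧
      S.org (S.dartArc c y) = S.org (S.dartArc c x) ∧
      S.org (S.dartArc c y') = S.org (S.dartArc c x) := by
  rcases h with ⟨a, h, -⟩ | ⟨a, h, -⟩ <;> simp at h <;> simp [h]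

theorem interleave_iff (hI : S.IsImmersion c left) (a : A) {x x' y y' : ZMod n × Bool}
    (hx : S.org (S.dartArc c x) = S.org a) (hx' : S.org (S.dartArc c x') = S.org a)
    (hy : S.org (S.dartArc c y) = S.org a) (hy' : S.org (S.dartArc c y') = S.org a) :
    S.Interleave c left x x' y y' ↔ Separate (S.pos c left a x) (S.pos c left a x')
      (S.pos c left a y) (S.pos c left a y') := by
  rw [Interleave, InCircularOrderOrOpposite, inCircularOrder_iff_pos hI a (by simp [*]),
    inCircularOrder_iff_pos hI a (by simp [*])]
  simp only [List.map_cons, List.map_nil, List.length_cons, List.length_nil, List.reverse_cons,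
    List.reverse_nil, List.nil_append, List.cons_append]
  generalize S.pos c left a x = p
  generalize S.pos c left a x' = p'
  generalize S.pos c left a y = q
  generalize S.pos c left a y' = q'
  constructor
  · rintro (⟨r, hr, h⟩ | ⟨r, hr, h⟩) <;> interval_cases r <;>
      simp [List.rotate_cons_succ] at h <;> unfold Separate <;> omega
  · intro h
    rcases h.cyclic with h | h | h | h | h | h | h | h
    · exact .inl ⟨0, by simp; omega⟩
    · exact .inl ⟨1, by simp; omega⟩
    · exact .inl ⟨2, by simp [List.rotate_cons_succ]; omega⟩
    · exact .inl ⟨3, by simp [List.rotate_cons_succ]; omega⟩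
    · exact .inr ⟨0, by simp; omega⟩
    · exact .inr ⟨1, by simp; omega⟩
    · exact .inr ⟨2, by simp [List.rotate_cons_succ]; omega⟩
    · exact .inr ⟨3, by simp [List.rotate_cons_succ]; omega⟩

theorem Interleave.swap_left (hI : S.IsImmersion c left) {x x' y y' : ZMod n × Bool}
    (h : S.Interleave c left x x' y y') : S.Interleave c left x' x y y' := by
  obtain ⟨h1, h2, h3⟩ := h.org_eq
  rw [interleave_iff hI _ rfl h1 h2 h3] at h
  rw [interleave_iff hI _ h1 rfl h2 h3]
  simp only [Separate] at *
  omega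

theorem Interleave.symm (hI : S.IsImmersion c left) {x x' y y' : ZMod n × Bool}
    (h : S.Interleave c left x x' y y') : S.Interleave c left y y' x x' := by
  obtain ⟨h1, h2, h3⟩ := h.org_eq
  rw [interleave_iff hI _ rfl h1 h2 h3] at h
  rw [interleave_iff hI _ h2 h3 rfl h1]
  simp only [Separate] at *
  omega

theorem Interleave.ne (hI : S.IsImmersion c left) {x x' y y' : ZMod n × Bool}
    (h : S.Interleave c left x x' y y') :
    x ≠ x' ∧ x ≠ y ∧ x ≠ y' ∧ x' ≠ y ∧ x' ≠ y' ∧ y ≠ y' := by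
  obtain ⟨h1, h2, h3⟩ := h.org_eq
  rw [interleave_iff hI _ rfl h1 h2 h3] at h
  refine ⟨?_, ?_, ?_, ?_, ?_, ?_⟩ <;> rintro rfl <;> simp only [Separate] at h <;> omega

/-- Of the three ways to pair four points of a circle, only one gives crossing chords. -/
theorem Interleave.not_uncrossed (hI : S.IsImmersion c left) {x x' y y' : ZMod n × Bool}
    (h : S.Interleave c left x x' y y') : ¬ S.Interleave c left x y' y x' := by
  obtain ⟨h1, h2, h3⟩ := h.org_eq
  rw [interleave_iff hI _ rfl h1 h2 h3] at h
  rw [interleave_iff hI _ rfl h3 h2 h1]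
  simp only [Separate] at *
  omega

open Classical in
/-- Uncrossing two crossing pairs does not increase the crossings with another pair. -/
theorem Interleave.uncross_le (hI : S.IsImmersion c left) {x x' y y' z z' : ZMod n × Bool}
    (h : S.Interleave c left x x' y y') (hz : z ≠ x ∧ z ≠ x' ∧ z ≠ y ∧ z ≠ y')
    (hz' : z' ≠ x ∧ z' ≠ x' ∧ z' ≠ y ∧ z' ≠ y') :
    (if S.Interleave c left x y' z z' then 1 else 0) +
        (if S.Interleave c left y x' z z' then 1 else 0) ≤
      (if S.Interleave c left x x' z z' then 1 else 0) +
        (if S.Interleave c left y y' z z' then 1 else 0) := by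
  obtain ⟨h1, h2, h3⟩ := h.org_eq
  -- Darts leaving different vertices never interleave, so only a chord `z z'` at the same vertex
  -- matters.
  by_cases hzz : S.org (S.dartArc c z) = S.org (S.dartArc c x) ∧
    S.org (S.dartArc c z') = S.org (S.dartArc c x)
  · obtain ⟨h4, h5⟩ := hzz
    rw [interleave_iff hI _ rfl h1 h2 h3] at h
    rw [interleave_iff hI _ rfl h3 h4 h5, interleave_iff hI _ h2 h1 h4 h5,
      interleave_iff hI _ rfl h1 h4 h5, interleave_iff hI _ h2 h3 h4 h5]
    have hp : ∀ {u v : ZMod n × Bool}, S.org (S.dartArc c u) = S.org (S.dartArc c x) →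
        S.org (S.dartArc c v) = S.org (S.dartArc c x) → u ≠ v →
        S.pos c left (S.dartArc c x) u ≠ S.pos c left (S.dartArc c x) v :=
      fun hu hv huv e => huv (pos_injOn hI hu hv e)
    have n1 := hp h4 rfl hz.1
    have n2 := hp h4 h1 hz.2.1
    have n3 := hp h4 h2 hz.2.2.1
    have n4 := hp h4 h3 hz.2.2.2
    have n5 := hp h5 rfl hz'.1
    have n6 := hp h5 h1 hz'.2.1
    have n7 := hp h5 h2 hz'.2.2.1
    have n8 := hp h5 h3 hz'.2.2.2
    rw [separate_iff n1 n4 n5 n8, separate_iff n3 n2 n7 n6, separate_iff n1 n2 n5 n6,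
      separate_iff n3 n4 n7 n8]
    have bad := h.not_separate n1 n2 n3 n4 n5 n6 n7 n8
    split_ifs <;> omega
  · have e1 : ¬ S.Interleave c left x y' z z' := fun h =>
      hzz ⟨h.org_eq.2.1, h.org_eq.2.2⟩
    have e2 : ¬ S.Interleave c left y x' z z' := fun h =>
      hzz ⟨h.org_eq.2.1.trans h2, h.org_eq.2.2.trans h2⟩
    simp [e1, e2]

end CombinatorialSurface

/-! ### Crossings as ordered pairs of darts, and the effect of one uncrossing -/

namespace CombinatorialSurface

variable {V A : Type*} {S : CombinatorialSurface V A}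
variable {n : ℕ} {c : ZMod n → A} {left : A → ZMod n → ZMod n → Prop}

/-! ### Counting crossings with darts -/

/-- The dart that follows the reverse of a dart along the curve, in the other direction: the two
darts of an index are partners. -/
def partner (n : ℕ) : Equiv.Perm (ZMod n × Bool) where
  toFun x := if x.2 then bwd x.1 else fwd (x.1 + 1)
  invFun x := if x.2 then bwd x.1 else fwd (x.1 + 1)
  left_inv x := by rcases x with ⟨t, b⟩; cases b <;> simp [fwd, bwd]
  right_inv x := by rcases x with ⟨t, b⟩; cases b <;> simp [fwd, bwd]

theorem partner_fwd (i : ZMod n) : partner n (fwd i) = bwd i := by simp [partner, fwd]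

theorem partner_bwd (i : ZMod n) : partner n (bwd i) = fwd i := by simp [partner, bwd]

theorem partner_partner (x : ZMod n × Bool) : partner n (partner n x) = x :=
  (partner n).left_inv x

theorem isCrossing_iff [Finite A] [NeZero n] (hI : S.IsImmersion c left) {i j : ZMod n} :
    S.IsCrossing c left i j ↔ S.Interleave c left (bwd i) (fwd i) (bwd j) (fwd j) := by
  refine ⟨fun h => h.2.2, fun h => ⟨?_, ?_, h⟩⟩
  · rintro rfl
    exact (h.ne hI).2.1 rfl
  · have h1 := h.org_eq
    exact h1.1.trans h1.2.2.symm

open Classical in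
/-- Number of ordered pairs of darts in crossing position, for the chords joining each dart `x` to
`N x`. -/
noncomputable def chordCount (S : CombinatorialSurface V A) (c : ZMod n → A)
    (left : A → ZMod n → ZMod n → Prop) [NeZero n] (N : Equiv.Perm (ZMod n × Bool)) : ℕ :=
  ∑ x, ∑ y, if S.Interleave c left x (N x) y (N y) then 1 else 0

variable [Finite A] [NeZero n]

/-- A crossing is counted twice for the order of its chords and twice for the chosen end of each,
hence the factor `8`. -/
theorem crossingNumber_eq (hI : S.IsImmersion c left) :
    8 * S.crossingNumber c left = S.chordCount c left (partner n) := by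
  classical
  -- With crossings as edges of a graph on the indices, the handshake lemma passes from unordered to
  -- ordered pairs.
  let G : SimpleGraph (ZMod n) :=
    { Adj := fun i j => S.Interleave c left (bwd i) (fwd i) (bwd j) (fwd j)
      symm := ⟨fun i j h => h.symm hI⟩
      loopless := ⟨fun i h => (h.ne hI).2.1 rfl⟩ }
  have h1 : {z : Sym2 (ZMod n) | ∃ i j, z = s(i, j) ∧ S.IsCrossing c left i j} = G.edgeSet := by
    ext z
    induction z using Sym2.ind with
    | _ i j =>
      simp only [Set.mem_ofPred_eq, SimpleGraph.mem_edgeSet, isCrossing_iff hI]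
      constructor
      · rintro ⟨i', j', h, h'⟩
        rcases Sym2.eq_iff.1 h with ⟨rfl, rfl⟩ | ⟨rfl, rfl⟩
        · exact h'
        · exact h'.symm hI
      · exact fun h => ⟨i, j, rfl, h⟩
  have h2 : 2 * S.crossingNumber c left =
      ∑ i, ∑ j, if S.Interleave c left (bwd i) (fwd i) (bwd j) (fwd j) then 1 else 0 := by
    rw [crossingNumber, h1, Set.ncard_eq_toFinset_card']
    have h3 := G.sum_degrees_eq_twice_card_edges
    rw [SimpleGraph.edgeFinset] at h3
    rw [← h3]
    refine Finset.sum_congr rfl fun i _ => ?_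
    rw [← SimpleGraph.card_neighborFinset_eq_degree, SimpleGraph.neighborFinset_eq_filter,
      Finset.card_filter]
  have hsum : ∀ g : ZMod n × Bool → ℕ, (∀ i, g (fwd i) = g (bwd i)) →
      ∑ x, g x = 2 * ∑ i, g (bwd i) := by
    intro g hg
    rw [Fintype.sum_prod_type]
    simp only [Fintype.sum_bool, Finset.sum_add_distrib]
    have e1 : ∑ i, g (i, true) = ∑ i, g (bwd i) := Finset.sum_congr rfl fun i _ => hg i
    have e2 : ∑ i, g (bwd i) = ∑ i, g (i, false) :=
      Equiv.sum_comp (Equiv.subRight (1 : ZMod n)) fun i => g (i, false)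
    rw [e1, ← e2, two_mul]
  have hflip : ∀ (i : ZMod n) (y : ZMod n × Bool),
      S.Interleave c left (fwd i) (bwd i) y (partner n y) ↔
        S.Interleave c left (bwd i) (fwd i) y (partner n y) :=
    fun i y => ⟨fun h => h.swap_left hI, fun h => h.swap_left hI⟩
  have hflip' : ∀ (i : ZMod n) (y y' : ZMod n × Bool),
      S.Interleave c left y y' (fwd i) (bwd i) ↔ S.Interleave c left y y' (bwd i) (fwd i) :=
    fun i y y' => ⟨fun h => ((h.symm hI).swap_left hI).symm hI,
      fun h => ((h.symm hI).swap_left hI).symm hI⟩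
  rw [chordCount, hsum _ (fun i => by simp only [partner_fwd, partner_bwd, hflip])]
  rw [show 8 = 2 * (2 * 2) by norm_num, mul_assoc, mul_assoc, h2, Finset.mul_sum]
  congr 1
  refine Finset.sum_congr rfl fun i _ => ?_
  rw [hsum _ (fun i => by simp only [partner_fwd, partner_bwd, hflip'])]
  simp only [partner_bwd]

open Equiv in
-- Conjugation by `swap α β` replaces the chords of `α` and `β` by `α, N β` and `β, N α`, and keeps
-- all others. The eight ordered pairs of the crossing disappear, and by `Interleave.uncross_le` no
-- third chord gains crossings.
theorem chordCount_uncross (hI : S.IsImmersion c left) {N : Perm (ZMod n × Bool)}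
    (hN : ∀ x, N (N x) = x) {α β : ZMod n × Bool}
    (h : S.Interleave c left α (N α) β (N β)) :
    S.chordCount c left (swap α β * N * swap α β) + 8 ≤ S.chordCount c left N := by
  classical
  obtain ⟨h1, h2, h3, h4, h5, h6⟩ := h.ne hI
  set N' := swap α β * N * swap α β with hN'
  have e1 : N' α = N β := by
    simp [N', Perm.mul_apply, swap_apply_of_ne_of_ne h3.symm h6.symm]
  have e2 : N' β = N α := by
    simp [N', Perm.mul_apply, swap_apply_of_ne_of_ne h1.symm h4]
  have e3 : N' (N α) = β := by
    simp [N', Perm.mul_apply, swap_apply_of_ne_of_ne h1.symm h4, hN]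
  have e4 : N' (N β) = α := by
    simp [N', Perm.mul_apply, swap_apply_of_ne_of_ne h3.symm h6.symm, hN]
  set s : Finset (ZMod n × Bool) := {α, N α, β, N β} with hs
  have sum_s : ∀ g : ZMod n × Bool → ℕ, ∑ x ∈ s, g x = g α + g (N α) + g β + g (N β) := by
    intro g
    rw [hs, Finset.sum_insert (by simp [*]), Finset.sum_insert (by simp [*]),
      Finset.sum_insert (by simp [*]), Finset.sum_singleton]
    ring
  have hmem : ∀ y, y ∉ s ↔ y ≠ α ∧ y ≠ N α ∧ y ≠ β ∧ y ≠ N β := by intro y; simp [hs]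
  have hNs : ∀ y, y ∉ s → N y ∉ s := by
    intro y hy
    rw [hmem] at *
    refine ⟨?_, ?_, ?_, ?_⟩ <;> intro e
    · exact hy.2.1 (by rw [← e, hN])
    · exact hy.1 (N.injective e)
    · exact hy.2.2.2 (by rw [← e, hN])
    · exact hy.2.2.1 (N.injective e)
  have hN's : ∀ y, y ∉ s → N' y = N y := by
    intro y hy
    have hy' := hNs y hy
    rw [hmem] at hy hy'
    simp [N', Perm.mul_apply, swap_apply_of_ne_of_ne hy.1 hy.2.2.1,
      swap_apply_of_ne_of_ne hy'.1 hy'.2.2.1]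
  have split : ∀ F : ZMod n × Bool → ZMod n × Bool → ℕ, (∀ x y, F x y = F y x) →
      ∑ x, ∑ y, F x y = ∑ x ∈ s, ∑ y ∈ s, F x y + 2 * (∑ y ∈ sᶜ, ∑ x ∈ s, F x y) +
        ∑ x ∈ sᶜ, ∑ y ∈ sᶜ, F x y := by
    intro F hF
    rw [← Finset.sum_add_sum_compl s]
    simp only [← Finset.sum_add_sum_compl s (F _), Finset.sum_add_distrib]
    rw [Finset.sum_comm (s := s) (t := sᶜ)]
    have : ∑ x ∈ sᶜ, ∑ y ∈ s, F x y = ∑ y ∈ sᶜ, ∑ x ∈ s, F x y :=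
      Finset.sum_congr rfl fun x _ => Finset.sum_congr rfl fun y _ => hF _ _
    rw [this]; ring
  have isymm : ∀ x x' y y', S.Interleave c left x x' y y' ↔ S.Interleave c left y y' x x' :=
    fun x x' y y' => ⟨fun h => h.symm hI, fun h => h.symm hI⟩
  have iswap : ∀ x x' y y', S.Interleave c left x x' y y' ↔ S.Interleave c left x' x y y' :=
    fun x x' y y' => ⟨fun h => h.swap_left hI, fun h => h.swap_left hI⟩
  have iself : ∀ x x', ¬ S.Interleave c left x x' x x' := fun x x' h => (h.ne hI).2.1 rfl
  have iself' : ∀ x x', ¬ S.Interleave c left x x' x' x := fun x x' h => (h.ne hI).2.2.1 rfl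
  have hu := h.not_uncrossed hI
  rw [chordCount, chordCount, split _ (fun x y => by rw [isymm]), split _ (fun x y => by rw [isymm])]
  have c1 : ∑ x ∈ sᶜ, ∑ y ∈ sᶜ, (if S.Interleave c left x (N' x) y (N' y) then 1 else 0) =
      ∑ x ∈ sᶜ, ∑ y ∈ sᶜ, (if S.Interleave c left x (N x) y (N y) then 1 else 0) := by
    refine Finset.sum_congr rfl fun x hx => Finset.sum_congr rfl fun y hy => ?_
    rw [hN's x (by simpa using hx), hN's y (by simpa using hy)]
  have c2 : ∑ y ∈ sᶜ, ∑ x ∈ s, (if S.Interleave c left x (N' x) y (N' y) then 1 else 0) ≤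
      ∑ y ∈ sᶜ, ∑ x ∈ s, (if S.Interleave c left x (N x) y (N y) then 1 else 0) := by
    refine Finset.sum_le_sum fun y hy => ?_
    have hy : y ∉ s := by simpa using hy
    have := h.uncross_le hI ((hmem y).1 hy) ((hmem _).1 (hNs y hy))
    rw [sum_s, sum_s, hN's y hy, e1, e2, e3, e4, hN, hN]
    rw [iswap (N α) β, iswap (N β) α, iswap (N α) α, iswap (N β) β]
    omega
  have c3 : ∑ x ∈ s, ∑ y ∈ s, (if S.Interleave c left x (N' x) y (N' y) then 1 else 0) = 0 := by
    have hu' : ¬ S.Interleave c left β (N α) α (N β) := fun h => hu ((isymm _ _ _ _).1 h)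
    have hu1 : ¬ S.Interleave c left α (N β) (N α) β := fun h =>
      hu ((isymm _ _ _ _).1 ((iswap _ _ _ _).1 ((isymm _ _ _ _).1 h)))
    have hu2 : ¬ S.Interleave c left β (N α) (N β) α := fun h =>
      hu' ((isymm _ _ _ _).1 ((iswap _ _ _ _).1 ((isymm _ _ _ _).1 h)))
    simp only [sum_s, e1, e2, e3, e4, iswap (N α) β, iswap (N β) α, iself, iself', hu, hu', hu1,
      hu2, if_false]
  have c4 : 8 ≤ ∑ x ∈ s, ∑ y ∈ s,
      (if S.Interleave c left x (N x) y (N y) then 1 else 0) := by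
    have h' := (isymm _ _ _ _).1 h
    have h1 : S.Interleave c left α (N α) (N β) β :=
      (isymm _ _ _ _).1 ((iswap _ _ _ _).1 h')
    have h2 : S.Interleave c left β (N β) (N α) α :=
      (isymm _ _ _ _).1 ((iswap _ _ _ _).1 h)
    simp only [sum_s, hN, iswap (N α) α, iswap (N β) β, h, h', h1, h2, if_true]
    omega
  omega

end CombinatorialSurface

/-! ### Primitivity, and the swap as a permutation of darts -/

namespace CombinatorialSurface

variable {V A : Type*} {S : CombinatorialSurface V A}
variable {n : ℕ} {c : ZMod n → A} {left : A → ZMod n → ZMod n → Prop}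

/-! ### Primitivity -/

theorem IsWalk.append {u v w : V} {p q : List A} (hp : S.IsWalk u p v) (hq : S.IsWalk v q w) :
    S.IsWalk u (p ++ q) w := by
  induction p generalizing u with
  | nil => obtain rfl : u = v := hp; exact hq
  | cons a p ih => exact ⟨hp.1, ih hp.2⟩

theorem isWalk_forwardPath (hc : S.IsClosedCurve c) (i : ZMod n) (m : ℕ) :
    S.IsWalk (S.org (c i)) (forwardPath c i m) (S.org (c (i + m))) := by
  induction m with
  | zero => simp [forwardPath, IsWalk]
  | succ m ih =>
    rw [forwardPath_succ]
    refine ih.append ⟨rfl, ?_⟩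
    rw [hc]
    push_cast
    rw [add_assoc]
    rfl

theorem freelyHomotopic_shift (hc : S.IsClosedCurve c) [NeZero n] (t : ℕ) :
    S.FreelyHomotopic (S.org (c 0), forwardPath c 0 n) (S.org (c t), forwardPath c t n) := by
  obtain ⟨l, rfl⟩ : ∃ l, n = l + 1 := ⟨n - 1, by have := NeZero.pos n; omega⟩
  induction t with
  | zero => rw [Nat.cast_zero]; exact .refl _
  | succ t ih =>
    refine ih.trans _ _ _ (.rel _ _ ?_)
    have h1 := isWalk_forwardPath hc (t : ZMod (l + 1)) (l + 1)
    rw [ZMod.natCast_self, add_zero, forwardPath_succ'] at h1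
    have h2 := FreeStep.shift _ _ h1
    have h3 : (t : ZMod (l + 1)) = (t : ZMod (l + 1)) + 1 + l := by
      have := ZMod.natCast_self (l + 1)
      push_cast at this
      rw [add_assoc, add_comm (1 : ZMod (l + 1)), this, add_zero]
    have h4 : forwardPath c (t + 1) l ++ [c t] = forwardPath c (t + 1) (l + 1) := by
      rw [forwardPath_succ, ← h3]
    rw [h4, hc, ← forwardPath_succ'] at h2
    rwa [Nat.cast_succ]

theorem PathHomotopic.freelyHomotopic {v w : V} {p q : List A} (h : S.PathHomotopic v w p q)
    {u : List A} (hu : S.IsWalk w u v) : S.FreelyHomotopic (w, u ++ p) (w, u ++ q) := by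
  induction h with
  | rel p q h =>
    refine .rel _ _ (.elementary _ _ _ (hu.append h.1) (hu.append h.2.1) ?_)
    cases h.2.2 with
    | spur u' w a => simpa using ElementaryStep.spur (S := S) (u ++ u') w a
    | face u' w a ha => simpa using ElementaryStep.face (S := S) (u ++ u') w a ha
  | refl => exact .refl _
  | symm _ _ _ ih => exact ih.symm
  | trans _ _ _ _ _ ih1 ih2 => exact ih1.trans _ _ _ ih2

/-- A primitive closed curve is not the concatenation of two homotopic closed walks. -/
theorem IsPrimitive.not_homotopic_halves [NeZero n] (hc : S.IsClosedCurve c)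
    (hprim : S.IsPrimitive c) {i : ZMod n} {ℓ : ℕ} (hn : ℓ + ℓ = n)
    (ho : S.org (c i) = S.org (c (i + ℓ)))
    (h : S.PathHomotopic (S.org (c i)) (S.org (c (i + ℓ))) (forwardPath c i ℓ)
      (forwardPath c (i + ℓ) ℓ)) : False := by
  have hw : S.IsWalk (S.org (c i)) (forwardPath c i ℓ) (S.org (c i)) := by
    conv => arg 4; rw [ho]
    exact isWalk_forwardPath hc i ℓ
  rw [← ho] at h
  refine hprim (S.org (c i)) (forwardPath c i ℓ) hw 2 le_rfl ?_
  have h1 := freelyHomotopic_shift hc i.val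
  rw [ZMod.natCast_val, ZMod.cast_id] at h1
  rw [imagePath_natCast]
  have h2 : forwardPath c i n = forwardPath c i ℓ ++ forwardPath c (i + ℓ) ℓ := by
    rw [← forwardPath_add, hn]
  rw [h2] at h1
  refine h1.trans _ _ _ ?_
  have h3 := PathHomotopic.freelyHomotopic (Relation.EqvGen.symm _ _ h) hw
  have h4 : (List.replicate 2 (forwardPath c i ℓ)).flatten =
      forwardPath c i ℓ ++ forwardPath c i ℓ := by simp [List.replicate]
  rw [h4]
  exact h3

/-! ### Exchanging the darts of the two sides -/

theorem pathIndex_pathPos (j : ZMod n) (k : ℤ) [NeZero n] (t : ZMod n) :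
    pathIndex j k (pathPos j k t) = t := by
  unfold pathIndex pathPos
  split_ifs
  · simp
  · rw [ZMod.natCast_val, ZMod.cast_id]; ring

theorem pathPos_lt (j : ZMod n) (k : ℤ) [NeZero n] (t : ZMod n) : pathPos j k t < n := by
  unfold pathPos
  split_ifs <;> exact ZMod.val_lt _

theorem pathPos_pathIndex (j : ZMod n) (k : ℤ) {p : ℕ} (hp : p < n) :
    pathPos j k (pathIndex j k p) = p := by
  unfold pathIndex pathPos
  split_ifs
  · rw [add_sub_cancel_left, ZMod.val_natCast_of_lt hp]
  · rw [show j - 1 - (j - p - 1) = (p : ZMod n) by ring, ZMod.val_natCast_of_lt hp]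

variable {i j : ZMod n} {ℓ : ℕ} {k : ℤ}

/-- The sides of lengths `ℓ > 0` and `|k| = ℓ` have no common arc occurrence. -/
structure DisjointSides (i : ZMod n) (ℓ : ℕ) (j : ZMod n) (k : ℤ) : Prop where
  pos : 0 < ℓ
  natAbs_eq : k.natAbs = ℓ
  disjoint : ∀ p < ℓ, ∀ q < ℓ, pathIndex i ℓ p ≠ pathIndex j k q

theorem DisjointSides.lt [NeZero n] (h : DisjointSides i ℓ j k) : ℓ < n := by
  by_contra hle
  refine h.disjoint (pathPos i ℓ (pathIndex j k 0)) ?_ 0 h.pos (pathIndex_pathPos _ _ _)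
  exact (pathPos_lt _ _ _).trans_le (by omega)

/-- The dart of index path `(j, k)` from its `p`-th to its `p + 1`-st index. -/
def outDart (j : ZMod n) (k : ℤ) (p : ℕ) : ZMod n × Bool := (pathIndex j k p, decide (0 < k))

/-- The dart of index path `(j, k)` from its `p + 1`-st to its `p`-th index. -/
def inDart (j : ZMod n) (k : ℤ) (p : ℕ) : ZMod n × Bool := (pathIndex j k p, !decide (0 < k))

theorem partner_outDart (j : ZMod n) (k : ℤ) (p : ℕ) :
    partner n (outDart j k (p + 1)) = inDart j k p := by
  by_cases hk : 0 < k
  · simp [partner, outDart, inDart, pathIndex, hk, bwd]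
    ring
  · simp [partner, outDart, inDart, pathIndex, hk, fwd]
    ring

theorem partner_inDart (j : ZMod n) (k : ℤ) (p : ℕ) :
    partner n (inDart j k p) = outDart j k (p + 1) := by
  rw [← partner_outDart, partner_partner]

/-- The exchange of the darts of the two sides. -/
def swapDart (i : ZMod n) (ℓ : ℕ) (j : ZMod n) (k : ℤ) (x : ZMod n × Bool) : ZMod n × Bool :=
  (swapIndex i ℓ j k x.1,
    if (pathPos i ℓ x.1 < ℓ ∨ pathPos j k x.1 < ℓ) ∧ k < 0 then !x.2 else x.2)

theorem dartArc_swapCurve (x : ZMod n × Bool) :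
    S.dartArc (S.swapCurve c i ℓ j k) x = S.dartArc c (swapDart i ℓ j k x) := by
  rcases x with ⟨t, b⟩
  by_cases h : (pathPos i ℓ t < ℓ ∨ pathPos j k t < ℓ) ∧ k < 0
  · cases b <;> simp only [dartArc, swapCurve, swapDart, h] <;> simp [S.inv_inv]
  · cases b <;> simp only [dartArc, swapCurve, swapDart, h] <;> simp

theorem occurs_swapCurve {a : A} {t : ZMod n} (h : S.Occurs (S.swapCurve c i ℓ j k) a t) :
    S.Occurs c a (swapIndex i ℓ j k t) := by
  unfold Occurs swapCurve at *
  split_ifs at h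
  · rcases h with h | h
    · right; rw [← h, S.inv_inv]
    · left; rwa [S.inv_injective.eq_iff] at h
  · exact h

section

variable [NeZero n] (h : DisjointSides i ℓ j k)
include h

theorem DisjointSides.pathPos_right {q : ℕ} (hq : q < ℓ) :
    ¬ pathPos i ℓ (pathIndex j k q) < ℓ := fun hp =>
  h.disjoint _ hp q hq (pathIndex_pathPos _ _ _)

theorem DisjointSides.swapIndex_left {p : ℕ} (hp : p < ℓ) :
    swapIndex i ℓ j k (pathIndex i ℓ p) = pathIndex j k p := by
  rw [swapIndex, pathPos_pathIndex _ _ (hp.trans h.lt), if_pos hp]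

theorem DisjointSides.swapIndex_right {p : ℕ} (hp : p < ℓ) :
    swapIndex i ℓ j k (pathIndex j k p) = pathIndex i ℓ p := by
  rw [swapIndex, if_neg (h.pathPos_right hp), pathPos_pathIndex _ _ (hp.trans h.lt), if_pos hp]

omit h in
theorem sides_cases (i : ZMod n) (ℓ : ℕ) (j : ZMod n) (k : ℤ) (t : ZMod n) :
    (∃ p < ℓ, t = pathIndex i ℓ p) ∨ (∃ p < ℓ, t = pathIndex j k p) ∨
      (¬ pathPos i ℓ t < ℓ ∧ ¬ pathPos j k t < ℓ) := by
  by_cases h1 : pathPos i ℓ t < ℓ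
  · exact .inl ⟨_, h1, (pathIndex_pathPos _ _ _).symm⟩
  by_cases h2 : pathPos j k t < ℓ
  · exact .inr (.inl ⟨_, h2, (pathIndex_pathPos _ _ _).symm⟩)
  exact .inr (.inr ⟨h1, h2⟩)

theorem DisjointSides.swapIndex_swapIndex (t : ZMod n) :
    swapIndex i ℓ j k (swapIndex i ℓ j k t) = t := by
  rcases sides_cases i ℓ j k t with ⟨p, hp, rfl⟩ | ⟨p, hp, rfl⟩ | ⟨h1, h2⟩
  · rw [h.swapIndex_left hp, h.swapIndex_right hp]
  · rw [h.swapIndex_right hp, h.swapIndex_left hp]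
  · have : swapIndex i ℓ j k t = t := by rw [swapIndex, if_neg h1, if_neg h2]
    rw [this, this]

theorem DisjointSides.swapDart_left {p : ℕ} (hp : p < ℓ) (b : Bool) :
    swapDart i ℓ j k (pathIndex i ℓ p, b) =
      (pathIndex j k p, if k < 0 then !b else b) := by
  simp only [swapDart, h.swapIndex_left hp, pathPos_pathIndex _ _ (hp.trans h.lt), hp, true_or,
    true_and]

theorem DisjointSides.swapDart_right {p : ℕ} (hp : p < ℓ) (b : Bool) :
    swapDart i ℓ j k (pathIndex j k p, b) =
      (pathIndex i ℓ p, if k < 0 then !b else b) := by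
  simp only [swapDart, h.swapIndex_right hp, pathPos_pathIndex _ _ (hp.trans h.lt), hp, or_true,
    true_and]

theorem DisjointSides.swapDart_swapDart (x : ZMod n × Bool) :
    swapDart i ℓ j k (swapDart i ℓ j k x) = x := by
  rcases x with ⟨t, b⟩
  rcases sides_cases i ℓ j k t with ⟨p, hp, rfl⟩ | ⟨p, hp, rfl⟩ | ⟨h1, h2⟩
  · rw [h.swapDart_left hp, h.swapDart_right hp]
    split_ifs <;> simp
  · rw [h.swapDart_right hp, h.swapDart_left hp]
    split_ifs <;> simp
  · have : swapDart i ℓ j k (t, b) = (t, b) := by simp [swapDart, swapIndex, h1, h2]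
    rw [this, this]

/-- The exchange of the darts of the two sides, as a permutation. -/
def DisjointSides.swapPerm : Equiv.Perm (ZMod n × Bool) where
  toFun := swapDart i ℓ j k
  invFun := swapDart i ℓ j k
  left_inv := h.swapDart_swapDart
  right_inv := h.swapDart_swapDart

omit [NeZero n] in
theorem DisjointSides.ne_zero : k ≠ 0 := by
  rintro rfl
  have := h.pos
  have := h.natAbs_eq
  simp at this; omega

theorem DisjointSides.swap_out {p : ℕ} (hp : p < ℓ) :
    h.swapPerm (outDart i ℓ p) = outDart j k p ∧ h.swapPerm (outDart j k p) = outDart i ℓ p := by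
  have h0 := h.ne_zero
  have h1 := h.pos
  refine ⟨(h.swapDart_left hp _).trans ?_, (h.swapDart_right hp _).trans ?_⟩
  all_goals
    by_cases hk : k < 0
    · have : ¬ 0 < k := by omega
      simp [outDart, hk, this, h1]
    · have : 0 < k := by omega
      simp [outDart, hk, this, h1]

theorem DisjointSides.swap_in {p : ℕ} (hp : p < ℓ) :
    h.swapPerm (inDart i ℓ p) = inDart j k p ∧ h.swapPerm (inDart j k p) = inDart i ℓ p := by
  have h0 := h.ne_zero
  have h1 := h.pos
  refine ⟨(h.swapDart_left hp _).trans ?_, (h.swapDart_right hp _).trans ?_⟩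
  all_goals
    by_cases hk : k < 0
    · have : ¬ 0 < k := by omega
      simp [inDart, hk, this, h1]
    · have : 0 < k := by omega
      simp [inDart, hk, this, h1]

omit [NeZero n] in
theorem DisjointSides.out_ne_out {p q : ℕ} (hp : p < ℓ) (hq : q < ℓ) :
    outDart i ℓ p ≠ outDart j k q := fun e => h.disjoint p hp q hq (congrArg Prod.fst e)

omit [NeZero n] in
theorem DisjointSides.in_ne_in {p q : ℕ} (hp : p < ℓ) (hq : q < ℓ) :
    inDart i ℓ p ≠ inDart j k q := fun e => h.disjoint p hp q hq (congrArg Prod.fst e)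

omit [NeZero n] in
theorem DisjointSides.out_ne_in {p q : ℕ} (hp : p < ℓ) (hq : q < ℓ) :
    outDart i ℓ p ≠ inDart j k q := fun e => h.disjoint p hp q hq (congrArg Prod.fst e)

omit [NeZero n] in
theorem DisjointSides.in_ne_out {p q : ℕ} (hp : p < ℓ) (hq : q < ℓ) :
    inDart i ℓ p ≠ outDart j k q := fun e => h.disjoint p hp q hq (congrArg Prod.fst e)

omit h [NeZero n] in
theorem outDart_ne_inDart (j : ZMod n) (k : ℤ) (p q : ℕ) : outDart j k p ≠ inDart j k q :=
  fun e => by simpa [outDart, inDart] using congrArg Prod.snd e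

omit h [NeZero n] in
theorem pathIndex_ne (j : ZMod n) (k : ℤ) {p q : ℕ} (hp : p < n) (hq : q < n) (hpq : p ≠ q) :
    pathIndex j k p ≠ pathIndex j k q := fun e => hpq <| by
  rw [← pathPos_pathIndex j k hp, e, pathPos_pathIndex j k hq]

/-- The exchange of the darts of the sides at the two tips. -/
def DisjointSides.tipPerm (_ : DisjointSides i ℓ j k) : Equiv.Perm (ZMod n × Bool) :=
  Equiv.swap (outDart i ℓ 0) (outDart j k 0) *
    Equiv.swap (inDart i ℓ (ℓ - 1)) (inDart j k (ℓ - 1))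

theorem DisjointSides.tipPerm_apply_out {p : ℕ} (hp : p + 1 < ℓ) :
    h.tipPerm (outDart i ℓ (p + 1)) = outDart i ℓ (p + 1) ∧
      h.tipPerm (outDart j k (p + 1)) = outDart j k (p + 1) := by
  have hn := h.lt
  have l1 : ℓ - 1 < ℓ := by omega
  have e1 : outDart i ℓ (p + 1) ≠ outDart i ℓ 0 := fun e =>
    pathIndex_ne i ℓ (by omega) (by omega) (Nat.succ_ne_zero p) (congrArg Prod.fst e)
  have e2 : outDart j k (p + 1) ≠ outDart j k 0 := fun e =>
    pathIndex_ne j k (by omega) (by omega) (Nat.succ_ne_zero p) (congrArg Prod.fst e)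
  unfold tipPerm
  constructor
  · rw [Equiv.Perm.mul_apply, Equiv.swap_apply_of_ne_of_ne (outDart_ne_inDart _ _ _ _)
      (h.out_ne_in hp l1), Equiv.swap_apply_of_ne_of_ne e1 (h.out_ne_out hp h.pos)]
  · rw [Equiv.Perm.mul_apply, Equiv.swap_apply_of_ne_of_ne (h.in_ne_out l1 hp).symm
      (outDart_ne_inDart _ _ _ _), Equiv.swap_apply_of_ne_of_ne (h.out_ne_out h.pos hp).symm e2]

theorem DisjointSides.tipPerm_apply_in {p : ℕ} (hp : p + 1 < ℓ) :
    h.tipPerm (inDart i ℓ p) = inDart i ℓ p ∧ h.tipPerm (inDart j k p) = inDart j k p := by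
  have hn := h.lt
  have l0 : p < ℓ := by omega
  have l1 : ℓ - 1 < ℓ := by omega
  have e1 : inDart i ℓ p ≠ inDart i ℓ (ℓ - 1) := fun e =>
    pathIndex_ne i ℓ (by omega) (by omega) (by omega) (congrArg Prod.fst e)
  have e2 : inDart j k p ≠ inDart j k (ℓ - 1) := fun e =>
    pathIndex_ne j k (by omega) (by omega) (by omega) (congrArg Prod.fst e)
  unfold tipPerm
  constructor
  · rw [Equiv.Perm.mul_apply, Equiv.swap_apply_of_ne_of_ne e1 (h.in_ne_in l0 l1),
      Equiv.swap_apply_of_ne_of_ne (outDart_ne_inDart _ _ _ _).symm (h.in_ne_out l0 h.pos)]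
  · rw [Equiv.Perm.mul_apply, Equiv.swap_apply_of_ne_of_ne (h.in_ne_in l1 l0).symm e2,
      Equiv.swap_apply_of_ne_of_ne (h.out_ne_in h.pos l0).symm (outDart_ne_inDart _ _ _ _).symm]

omit [NeZero n] in
theorem DisjointSides.tipPerm_apply_tips :
    h.tipPerm (outDart i ℓ 0) = outDart j k 0 ∧ h.tipPerm (outDart j k 0) = outDart i ℓ 0 ∧
      h.tipPerm (inDart i ℓ (ℓ - 1)) = inDart j k (ℓ - 1) ∧
      h.tipPerm (inDart j k (ℓ - 1)) = inDart i ℓ (ℓ - 1) := by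
  have hp := h.pos
  have l1 : ℓ - 1 < ℓ := by omega
  unfold tipPerm
  refine ⟨?_, ?_, ?_, ?_⟩ <;> rw [Equiv.Perm.mul_apply]
  · rw [Equiv.swap_apply_of_ne_of_ne (outDart_ne_inDart _ _ _ _) (h.out_ne_in hp l1),
      Equiv.swap_apply_left]
  · rw [Equiv.swap_apply_of_ne_of_ne (h.in_ne_out l1 hp).symm (outDart_ne_inDart _ _ _ _),
      Equiv.swap_apply_right]
  · rw [Equiv.swap_apply_left, Equiv.swap_apply_of_ne_of_ne (h.out_ne_in hp l1).symm
      (outDart_ne_inDart _ _ _ _).symm]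
  · rw [Equiv.swap_apply_right, Equiv.swap_apply_of_ne_of_ne (outDart_ne_inDart _ _ _ _).symm
      (h.in_ne_out l1 hp)]

theorem DisjointSides.tipPerm_apply_of_ne {x : ZMod n × Bool} (h1 : ¬ pathPos i ℓ x.1 < ℓ)
    (h2 : ¬ pathPos j k x.1 < ℓ) : h.tipPerm x = x := by
  have hn := h.lt
  have hp := h.pos
  have key : ∀ {p b}, p < ℓ → x ≠ (pathIndex i ℓ p, b) := by
    rintro p b hp rfl
    exact h1 (by rwa [pathPos_pathIndex _ _ (by omega)])
  have key' : ∀ {p b}, p < ℓ → x ≠ (pathIndex j k p, b) := by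
    rintro p b hp rfl
    exact h2 (by rwa [pathPos_pathIndex _ _ (by omega)])
  unfold tipPerm
  have l1 : ℓ - 1 < ℓ := by omega
  have e1 : Equiv.swap (inDart i ℓ (ℓ - 1)) (inDart j k (ℓ - 1)) x = x :=
    Equiv.swap_apply_of_ne_of_ne (key l1) (key' l1)
  rw [Equiv.Perm.mul_apply, e1]
  exact Equiv.swap_apply_of_ne_of_ne (key hp) (key' hp)

omit h [NeZero n] in
theorem eq_outDart_or_inDart (j : ZMod n) (k : ℤ) (p : ℕ) (b : Bool) :
    (pathIndex j k p, b) = outDart j k p ∨ (pathIndex j k p, b) = inDart j k p := by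
  unfold outDart inDart
  cases b <;> cases decide (0 < k) <;> simp

/-- Darts off the sides are moved by neither exchange, and the end darts of the sides are exchanged
twice. The remaining darts sit at interior indices of the sides. -/
theorem DisjointSides.dart_cases (x : ZMod n × Bool) :
    h.tipPerm (h.swapPerm x) = x ∨ ∃ p, p + 1 < ℓ ∧ (x = outDart i ℓ (p + 1) ∨
      x = outDart j k (p + 1) ∨ x = inDart i ℓ p ∨ x = inDart j k p) := by
  obtain ⟨t1, t2, t3, t4⟩ := h.tipPerm_apply_tips
  have hout : ∀ p < ℓ, p = 0 ∨ ∃ q, q + 1 < ℓ ∧ p = q + 1 := by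
    rintro (_ | p) hp
    · exact .inl rfl
    · exact .inr ⟨p, hp, rfl⟩
  rcases x with ⟨t, b⟩
  rcases sides_cases i ℓ j k t with ⟨p, hp, rfl⟩ | ⟨p, hp, rfl⟩ | ⟨h1, h2⟩
  · rcases eq_outDart_or_inDart i ℓ p b with e | e <;> rw [e]
    · rcases hout p hp with rfl | ⟨q, hq, rfl⟩
      · left; rw [(h.swap_out hp).1, t2]
      · exact .inr ⟨q, hq, .inl rfl⟩
    · by_cases hq : p + 1 < ℓ
      · exact .inr ⟨p, hq, by simp⟩
      · obtain rfl : p = ℓ - 1 := by omega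
        left; rw [(h.swap_in hp).1, t4]
  · rcases eq_outDart_or_inDart j k p b with e | e <;> rw [e]
    · rcases hout p hp with rfl | ⟨q, hq, rfl⟩
      · left; rw [(h.swap_out hp).2, t1]
      · exact .inr ⟨q, hq, by simp⟩
    · by_cases hq : p + 1 < ℓ
      · exact .inr ⟨p, hq, by simp⟩
      · obtain rfl : p = ℓ - 1 := by omega
        left; rw [(h.swap_in hp).2, t3]
  · left
    have : h.swapPerm (t, b) = (t, b) := by
      change swapDart i ℓ j k (t, b) = (t, b)
      simp [swapDart, swapIndex, h1, h2]
    rw [this, h.tipPerm_apply_of_ne h1 h2]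

/-- At an interior index of a side both partners belong to that side, so they move together to the
corresponding pair of the other side; away from these indices nothing moves. -/
theorem DisjointSides.commute_partner (x : ZMod n × Bool) :
    h.tipPerm (h.swapPerm (partner n x)) = partner n (h.tipPerm (h.swapPerm x)) := by
  have moving : ∀ {x : ZMod n × Bool} {p : ℕ}, p + 1 < ℓ → (x = outDart i ℓ (p + 1) ∨
      x = outDart j k (p + 1) ∨ x = inDart i ℓ p ∨ x = inDart j k p) →
      h.tipPerm (h.swapPerm (partner n x)) = partner n (h.tipPerm (h.swapPerm x)) := by
    intro x p hp hx
    have s1 := h.swap_out hp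
    have s2 := h.swap_in (Nat.lt_of_succ_lt hp)
    have s3 := h.tipPerm_apply_out hp
    have s4 := h.tipPerm_apply_in hp
    rcases hx with rfl | rfl | rfl | rfl <;>
      simp only [partner_outDart, partner_inDart, s1, s2, s3, s4]
  rcases h.dart_cases x with hx | ⟨p, hp, hx⟩
  · rcases h.dart_cases (partner n x) with hy | ⟨p, hp, hy⟩
    · rw [hy, hx]
    -- Apply the interior case to the partner of `x`, and use that `partner` is an involution.
    · have := moving hp hy
      rw [partner_partner, hx] at this
      rw [hx]
      nth_rw 2 [this]
      rw [partner_partner]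
  · exact moving hp hx

/-- Conjugating the partner map by the swap amounts to conjugating it by the swap at the tips. -/
theorem DisjointSides.conj_partner :
    h.swapPerm * partner n * h.swapPerm⁻¹ = h.tipPerm⁻¹ * partner n * h.tipPerm := by
  have h1 : (h.tipPerm * h.swapPerm) * partner n = partner n * (h.tipPerm * h.swapPerm) :=
    Equiv.ext h.commute_partner
  rw [mul_inv_eq_iff_eq_mul, mul_assoc, mul_assoc, ← h1]
  group

end

/-! ### The swapped curve -/

theorem before_swap {a : A} {x y : ZMod n × Bool} :
    S.Before (S.swapCurve c i ℓ j k) (swapOrder left i ℓ j k) a x y ↔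
      S.Before c left a (swapDart i ℓ j k x) (swapDart i ℓ j k y) := by
  simp only [Before, dartArc_swapCurve]
  rfl

theorem inCircularOrder_swap {L : List (ZMod n × Bool)} :
    S.InCircularOrder (S.swapCurve c i ℓ j k) (swapOrder left i ℓ j k) L ↔
      S.InCircularOrder c left (L.map (swapDart i ℓ j k)) := by
  simp only [InCircularOrder, dartArc_swapCurve, List.forall_mem_map, ← List.map_rotate,
    List.pairwise_map, before_swap.symm]

theorem interleave_swap {x x' y y' : ZMod n × Bool} :
    S.Interleave (S.swapCurve c i ℓ j k) (swapOrder left i ℓ j k) x x' y y' ↔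
      S.Interleave c left (swapDart i ℓ j k x) (swapDart i ℓ j k x') (swapDart i ℓ j k y)
        (swapDart i ℓ j k y') := by
  simp [Interleave, InCircularOrderOrOpposite, inCircularOrder_swap]

variable [NeZero n]

theorem DisjointSides.isImmersion_swap (h : DisjointSides i ℓ j k) (hI : S.IsImmersion c left) :
    S.IsImmersion (S.swapCurve c i ℓ j k) (swapOrder left i ℓ j k) where
  irrefl a s hs := hI.irrefl a _ (occurs_swapCurve hs)
  trans a r s t hr hs ht := hI.trans a _ _ _ (occurs_swapCurve hr) (occurs_swapCurve hs)
    (occurs_swapCurve ht)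
  total a s t hs ht hst := hI.total a _ _ (occurs_swapCurve hs) (occurs_swapCurve ht) fun e =>
    hst (by rw [← h.swapIndex_swapIndex s, e, h.swapIndex_swapIndex])
  opposite a s t hs ht := hI.opposite a _ _ (occurs_swapCurve hs) (occurs_swapCurve ht)

/-- Relabelling by `swapPerm` carries the swapped immersion back to the original darts and orders;
only the pairing into chords has changed, and `conj_partner` confines this change to the tips. -/
theorem DisjointSides.chordCount_swap (h : DisjointSides i ℓ j k) :
    S.chordCount (S.swapCurve c i ℓ j k) (swapOrder left i ℓ j k) (partner n) =
      S.chordCount c left (h.tipPerm⁻¹ * partner n * h.tipPerm) := by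
  classical
  rw [← h.conj_partner]
  refine Fintype.sum_equiv h.swapPerm _ _ fun x => Fintype.sum_equiv h.swapPerm _ _ fun y => ?_
  have e : ∀ x, (h.swapPerm * partner n * h.swapPerm⁻¹) (h.swapPerm x) =
      swapDart i ℓ j k (partner n x) := fun x => by
    have hx : h.swapPerm⁻¹ (h.swapPerm x) = x := h.swapPerm.symm_apply_apply x
    rw [Equiv.Perm.mul_apply, Equiv.Perm.mul_apply, hx]
    rfl
  rw [e, e]
  exact if_congr interleave_swap rfl rfl

omit [NeZero n] in
theorem org_partner (hc : S.IsClosedCurve c) (x : ZMod n × Bool) :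
    S.org (S.dartArc c (partner n x)) = S.org (S.dartArc c x) := by
  rcases x with ⟨t, b⟩
  cases b
  · simp only [partner, dartArc, Equiv.coe_fn_mk, fwd]
    exact (hc t).symm
  · have := hc (t - 1)
    rw [sub_add_cancel] at this
    exact this

/-- Closedness says that partner darts have the same origin. The exchange at the tips preserves
origins, and its composite with the swap commutes with `partner`. -/
theorem DisjointSides.isClosedCurve_swap (h : DisjointSides i ℓ j k) (hc : S.IsClosedCurve c)
    (h1 : S.org (S.dartArc c (outDart i ℓ 0)) = S.org (S.dartArc c (outDart j k 0)))
    (h2 : S.org (S.dartArc c (inDart i ℓ (ℓ - 1))) =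
      S.org (S.dartArc c (inDart j k (ℓ - 1)))) :
    S.IsClosedCurve (S.swapCurve c i ℓ j k) := by
  have hswap : ∀ {α β : ZMod n × Bool}, S.org (S.dartArc c α) = S.org (S.dartArc c β) →
      ∀ x, S.org (S.dartArc c (Equiv.swap α β x)) = S.org (S.dartArc c x) := by
    intro α β hαβ x
    rw [Equiv.swap_apply_def]
    split_ifs with e1 e2
    · rw [e1, hαβ]
    · rw [e2, hαβ]
    · rfl
  have htip : ∀ x, S.org (S.dartArc c (h.tipPerm x)) = S.org (S.dartArc c x) := by
    intro x
    rw [tipPerm, Equiv.Perm.mul_apply, hswap h1, hswap h2]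
  intro t
  have e1 : S.org (S.dartArc (S.swapCurve c i ℓ j k) (t, false)) =
      S.org (S.dartArc (S.swapCurve c i ℓ j k) (partner n (t, false))) := by
    rw [dartArc_swapCurve, dartArc_swapCurve]
    have := h.commute_partner (t, false)
    change S.org (S.dartArc c (h.swapPerm _)) = S.org (S.dartArc c (h.swapPerm _))
    rw [← htip (h.swapPerm (partner n (t, false))), this, org_partner hc, htip]
  simpa [partner, fwd, dartArc, tgt] using e1

end CombinatorialSurface

/-! ### Uncrossing two tips, possibly with a common index -/

namespace CombinatorialSurface

variable {V A : Type*} {S : CombinatorialSurface V A}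
variable {n : ℕ} {c : ZMod n → A} {left : A → ZMod n → ZMod n → Prop}

/-! ### Uncrossing the two tips of a bigon -/

theorem InCircularOrder.of_rotate {L : List (ZMod n × Bool)} (s : ℕ)
    (h : S.InCircularOrder c left (L.rotate s)) : S.InCircularOrder c left L := by
  obtain ⟨a, h1, r, h2⟩ := h
  exact ⟨a, fun x hx => h1 x (List.mem_rotate.2 hx), s + r, by rwa [← List.rotate_rotate]⟩

theorem fwd_ne_bwd (s t : ZMod n) : fwd s ≠ bwd t := fun e => by
  simpa [fwd, bwd] using congrArg Prod.snd e

theorem fwd_injective : Function.Injective (fwd (n := n)) := fun _ _ e => congrArg Prod.fst e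

theorem bwd_injective : Function.Injective (bwd (n := n)) := fun s t e => by simpa [bwd] using e

variable [Finite A] [NeZero n]

open Equiv in
theorem chordCount_uncross_two (hI : S.IsImmersion c left) {N : Perm (ZMod n × Bool)}
    (hN : ∀ x, N (N x) = x) {α β γ δ : ZMod n × Bool}
    (h1 : S.Interleave c left α (N α) β (N β))
    (h2 : S.Interleave c left γ (swap α β (N (swap α β γ))) δ (swap α β (N (swap α β δ)))) :
    S.chordCount c left (swap γ δ * (swap α β * N * swap α β) * swap γ δ) + 16 ≤
      S.chordCount c left N := by
  have e1 := chordCount_uncross hI hN h1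
  have e2 := chordCount_uncross hI (N := swap α β * N * swap α β) (α := γ) (β := δ)
    (by simp [Perm.mul_apply, hN]) h2
  omega

/-- Darts on two equal or consecutive arcs are not separated by darts on other arcs. -/
theorem not_interleave_of_rot (hI : S.IsImmersion c left) {x y z w : ZMod n × Bool}
    (hxy : S.dartArc c x = S.dartArc c y ∨ S.rot (S.dartArc c x) = S.dartArc c y)
    (hzx : S.dartArc c z ≠ S.dartArc c x) (hzy : S.dartArc c z ≠ S.dartArc c y)
    (hwx : S.dartArc c w ≠ S.dartArc c x) (hwy : S.dartArc c w ≠ S.dartArc c y) :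
    ¬ S.Interleave c left x y z w := by
  intro h
  obtain ⟨h1, h2, h3⟩ := h.org_eq
  -- Counted from the arc of `x`, the darts `x` and `y` have rank at most `1` and every dart on
  -- another arc comes after both.
  have before : ∀ {u}, S.org (S.dartArc c u) = S.org (S.dartArc c x) →
      S.dartArc c u ≠ S.dartArc c x → S.dartArc c u ≠ S.dartArc c y →
      S.rank (S.dartArc c x) (S.dartArc c x) < S.rank (S.dartArc c x) (S.dartArc c u) ∧
      S.rank (S.dartArc c x) (S.dartArc c y) < S.rank (S.dartArc c x) (S.dartArc c u) := by
    intro u hu hux huy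
    have hs := (rank_spec hu).2
    have r0 : S.rank (S.dartArc c x) (S.dartArc c x) ≤ 0 := Nat.sInf_le (by simp)
    have hne0 : S.rank (S.dartArc c x) (S.dartArc c u) ≠ 0 := by
      intro e
      rw [e] at hs
      exact hux hs.symm
    refine ⟨by omega, ?_⟩
    rcases hxy with hxy | hxy
    · rw [← hxy]; omega
    · have r1 : S.rank (S.dartArc c x) (S.dartArc c y) ≤ 1 := Nat.sInf_le (by simpa using hxy)
      have hne1 : S.rank (S.dartArc c x) (S.dartArc c u) ≠ 1 := by
        intro e
        rw [e, pow_one, hxy] at hs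
        exact huy hs.symm
      omega
  rw [interleave_iff hI _ rfl h1 h2 h3] at h
  have p1 := pos_lt_of_before hI (left := left) rfl (.inl (before h2 hzx hzy).1)
  have p2 := pos_lt_of_before hI (left := left) h1 (.inl (before h2 hzx hzy).2)
  have p3 := pos_lt_of_before hI (left := left) rfl (.inl (before h3 hwx hwy).1)
  have p4 := pos_lt_of_before hI (left := left) h1 (.inl (before h3 hwx hwy).2)
  unfold Separate at h
  omega

/-- The pairs `p, p'`, `q, q'`, `r, r'` stand for the backward and forward darts at `i`, `j`, `m`.
The alternatives are the six rotations of `p q p' r' q' r` and those of its reverse. -/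
theorem cyclic_of_separate {p p' q q' r r' : ℕ} (h1 : Separate p p' q q') (h2 : Separate q q' r r')
    (h3 : ¬ Separate q p' r r') (h4 : ¬ Separate p' p q' r) (h5 : ¬ Separate p' q' q r)
    (n1 : r ≠ p) (n2 : r ≠ p') (n3 : r' ≠ p) (n4 : r' ≠ p') :
    (p < q ∧ q < p' ∧ p' < r' ∧ r' < q' ∧ q' < r) ∨ (q < p' ∧ p' < r' ∧ r' < q' ∧ q' < r ∧ r < p) ∨
    (p' < r' ∧ r' < q' ∧ q' < r ∧ r < p ∧ p < q) ∨ (r' < q' ∧ q' < r ∧ r < p ∧ p < q ∧ q < p') ∨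
    (q' < r ∧ r < p ∧ p < q ∧ q < p' ∧ p' < r') ∨ (r < p ∧ p < q ∧ q < p' ∧ p' < r' ∧ r' < q') ∨
    (r < q' ∧ q' < r' ∧ r' < p' ∧ p' < q ∧ q < p) ∨ (q' < r' ∧ r' < p' ∧ p' < q ∧ q < p ∧ p < r) ∨
    (r' < p' ∧ p' < q ∧ q < p ∧ p < r ∧ r < q') ∨ (p' < q ∧ q < p ∧ p < r ∧ r < q' ∧ q' < r') ∨
    (q < p ∧ p < r ∧ r < q' ∧ q' < r' ∧ r' < p') ∨
      (p < r ∧ r < q' ∧ q' < r' ∧ r' < p' ∧ p' < q) := by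
  rcases h1.cyclic with h | h | h | h | h | h | h | h <;> unfold Separate at h2 h3 h4 h5
  · have a : p' < r' ∧ r' < q' := by omega
    have b : q' < r ∨ r < p := by omega
    rcases b with b | b <;> simp only [h, a, b, true_and, and_true, true_or, or_true]
  · have a : p' < r' ∧ r' < q' := by omega
    have b : q' < r ∧ r < p := by omega
    simp only [h, a, b, true_and, and_true, true_or, or_true]
  · have a : p' < r' ∧ r' < q' := by omega
    have b : q' < r ∧ r < p := by omega
    simp only [h, a, b, true_and, and_true, true_or, or_true]
  · have a : p' < r' ∨ r' < q' := by omega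
    have b : q' < r ∧ r < p := by omega
    rcases a with a | a <;> simp only [h, a, b, true_and, and_true, true_or, or_true]
  · have a : q' < r' ∧ r' < p' := by omega
    have b : p < r ∨ r < q' := by omega
    rcases b with b | b <;> simp only [h, a, b, true_and, and_true, true_or, or_true]
  · have a : q' < r' ∨ r' < p' := by omega
    have b : p < r ∧ r < q' := by omega
    rcases a with a | a <;> simp only [h, a, b, true_and, and_true, true_or, or_true]
  · have a : q' < r' ∧ r' < p' := by omega
    have b : p < r ∧ r < q' := by omega
    simp only [h, a, b, true_and, and_true, true_or, or_true]
  · have a : q' < r' ∧ r' < p' := by omega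
    have b : p < r ∧ r < q' := by omega
    simp only [h, a, b, true_and, and_true, or_true]

open Equiv in
/-- Uncrossing the tips of two consecutive sides, from `i` to `j` and from `j` to `m`. -/
theorem chordCount_uncross_consecutive (hI : S.IsImmersion c left) {i j m : ZMod n}
    (him : i ≠ m) (h1 : S.Interleave c left (bwd i) (fwd i) (bwd j) (fwd j))
    (h2 : S.Interleave c left (bwd j) (fwd j) (bwd m) (fwd m))
    (hgeom : ¬ S.Interleave c left (fwd i) (fwd j) (bwd j) (bwd m))
    (hord : ¬ S.InCircularOrderOrOpposite c left [bwd i, bwd j, fwd i, fwd m, fwd j, bwd m]) :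
    S.chordCount c left (swap (bwd j) (bwd m) * (swap (fwd i) (fwd j) * partner n *
      swap (fwd i) (fwd j)) * swap (bwd j) (bwd m)) + 16 ≤ S.chordCount c left (partner n) := by
  have fb := fwd_ne_bwd (n := n)
  have ff : ∀ {s t : ZMod n}, s ≠ t → fwd s ≠ fwd t := fun h => fwd_injective.ne h
  have bb : ∀ {s t : ZMod n}, s ≠ t → bwd s ≠ bwd t := fun h => bwd_injective.ne h
  have hij : i ≠ j := by rintro rfl; exact (h1.ne hI).2.1 rfl
  have hjm : j ≠ m := by rintro rfl; exact (h2.ne hI).2.1 rfl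
  -- The new chord `bwd j, fwd i` still crosses the chord of `m`: uncross the tip of `i` and `j`
  -- first.
  by_cases hA : S.Interleave c left (bwd j) (fwd i) (bwd m) (fwd m)
  · refine chordCount_uncross_two hI partner_partner ?_ ?_
    · rw [partner_fwd, partner_fwd]
      exact ((h1.swap_left hI).symm hI |>.swap_left hI).symm hI
    · rw [swap_apply_of_ne_of_ne (fb _ _).symm (fb _ _).symm, partner_bwd, swap_apply_right,
        swap_apply_of_ne_of_ne (fb _ _).symm (fb _ _).symm, partner_bwd,
        swap_apply_of_ne_of_ne (ff him.symm) (ff hjm.symm)]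
      exact hA
  -- Here uncrossing the tip of `j` and `m` first leaves a crossing to undo. The exchanges involve
  -- distinct darts, so their order is immaterial to the result.
  by_cases hB : S.Interleave c left (fwd i) (bwd i) (fwd j) (bwd m)
  · have hcomm : Commute (swap (fwd i) (fwd j)) (swap (bwd j) (bwd m)) := by
      refine (Perm.disjoint_iff_eq_or_eq.2 fun x => ?_).commute
      by_cases hx : x = fwd i ∨ x = fwd j
      · right
        rcases hx with rfl | rfl <;> exact swap_apply_of_ne_of_ne (fb _ _) (fb _ _)
      · left
        rw [not_or] at hx
        exact swap_apply_of_ne_of_ne hx.1 hx.2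
    have e : swap (bwd j) (bwd m) * (swap (fwd i) (fwd j) * partner n * swap (fwd i) (fwd j)) *
        swap (bwd j) (bwd m) = swap (fwd i) (fwd j) * (swap (bwd j) (bwd m) * partner n *
          swap (bwd j) (bwd m)) * swap (fwd i) (fwd j) := by
      simp only [mul_assoc]
      rw [hcomm.eq, ← mul_assoc, ← hcomm.eq, mul_assoc]
    rw [e]
    refine chordCount_uncross_two hI partner_partner ?_ ?_
    · rw [partner_bwd, partner_bwd]
      exact h2
    · rw [swap_apply_of_ne_of_ne (fb _ _) (fb _ _), partner_fwd,
        swap_apply_of_ne_of_ne (bb hij) (bb him), swap_apply_of_ne_of_ne (fb _ _) (fb _ _),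
        partner_fwd, swap_apply_left]
      exact hB
  -- If neither order works, the crossings and the local geometry force the excluded cyclic order.
  refine (hord ?_).elim
  obtain ⟨o1, o2, o3⟩ := h1.org_eq
  obtain ⟨o4, o5, o6⟩ := h2.org_eq
  have o5 := o5.trans o2
  have o6 := o6.trans o2
  have hp : ∀ {u v : ZMod n × Bool}, S.org (S.dartArc c u) = S.org (S.dartArc c (bwd i)) →
      S.org (S.dartArc c v) = S.org (S.dartArc c (bwd i)) → u ≠ v →
      S.pos c left (S.dartArc c (bwd i)) u ≠ S.pos c left (S.dartArc c (bwd i)) v :=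
    fun hu hv huv e => huv (pos_injOn hI hu hv e)
  have n1 := hp o5 rfl (bb him.symm)
  have n2 := hp o5 o1 (fb _ _).symm
  have n3 := hp o6 rfl (fb _ _)
  have n4 := hp o6 o1 (ff him.symm)
  rw [interleave_iff hI _ rfl o1 o2 o3] at h1
  rw [interleave_iff hI _ o2 o3 o5 o6] at h2
  rw [interleave_iff hI _ o2 o1 o5 o6] at hA
  rw [interleave_iff hI _ o1 rfl o3 o5] at hB
  rw [interleave_iff hI _ o1 o3 o2 o5] at hgeom
  have hcyc := cyclic_of_separate h1 h2 hA hB hgeom n1 n2 n3 n4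
  rw [InCircularOrderOrOpposite,
    inCircularOrder_iff_pos hI (S.dartArc c (bwd i)) (by simp [*]),
    inCircularOrder_iff_pos hI (S.dartArc c (bwd i)) (by simp [*])]
  simp only [List.map_cons, List.map_nil, List.length_cons, List.length_nil, List.reverse_cons,
    List.reverse_nil, List.nil_append, List.cons_append]
  clear hp h1 h2 hA hB hgeom n1 n2 n3 n4 hord
  rcases hcyc with h | h | h | h | h | h | h | h | h | h | h | h
  · exact .inl ⟨0, by simp; omega⟩
  · exact .inl ⟨1, by simp; omega⟩
  · exact .inl ⟨2, by simp [List.rotate_cons_succ]; omega⟩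
  · exact .inl ⟨3, by simp [List.rotate_cons_succ]; omega⟩
  · exact .inl ⟨4, by simp [List.rotate_cons_succ]; omega⟩
  · exact .inl ⟨5, by simp [List.rotate_cons_succ]; omega⟩
  · exact .inr ⟨0, by simp; omega⟩
  · exact .inr ⟨1, by simp; omega⟩
  · exact .inr ⟨2, by simp [List.rotate_cons_succ]; omega⟩
  · exact .inr ⟨3, by simp [List.rotate_cons_succ]; omega⟩
  · exact .inr ⟨4, by simp [List.rotate_cons_succ]; omega⟩
  · exact .inr ⟨5, by simp [List.rotate_cons_succ]; omega⟩

end CombinatorialSurface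

/-! ### Singular bigons and conclusion -/

namespace CombinatorialSurface

variable {V A : Type*} {S : CombinatorialSurface V A}
variable {n : ℕ} {c : ZMod n → A} {left : A → ZMod n → ZMod n → Prop}

/-! ### Singular bigons -/

theorem outDart_zero {ℓ : ℕ} (hℓ : 0 < ℓ) (i : ZMod n) : outDart i ℓ 0 = fwd i := by
  simp [outDart, pathIndex, hℓ, fwd]

theorem inDart_last {ℓ : ℕ} (hℓ : 0 < ℓ) (i : ZMod n) : inDart i ℓ (ℓ - 1) = bwd (i + (ℓ : ZMod n)) := by
  simp [inDart, pathIndex, hℓ, bwd, Nat.cast_sub (show 1 ≤ ℓ from hℓ)]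
  ring

theorem outDart_neg_zero (ℓ : ℕ) (j : ZMod n) : outDart j (-(ℓ : ℤ)) 0 = bwd j := by
  simp [outDart, pathIndex, bwd]

theorem inDart_neg_last {ℓ : ℕ} (hℓ : 0 < ℓ) (j : ZMod n) :
    inDart j (-(ℓ : ℤ)) (ℓ - 1) = fwd (j + ((-(ℓ : ℤ) : ℤ) : ZMod n)) := by
  have h0 : ¬ (ℓ : ℤ) < 0 := by omega
  simp [inDart, pathIndex, fwd, h0, Nat.cast_sub (show 1 ≤ ℓ from hℓ)]
  ring

variable [NeZero n] {i j : ZMod n} {ℓ : ℕ} {k : ℤ}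

/-- A side longer than `n` would contain every occurrence, in particular the first one of the other
side. -/
theorem IsSingularBigon.length_le (h : S.IsSingularBigon c left i ℓ j k) :
    ℓ ≤ n ∧ k.natAbs ≤ n := by
  have h0 := h.length_ne
  constructor <;> by_contra hlt
  · refine h.disjoint (pathPos i ℓ (pathIndex j k 0)) ?_ 0 (by omega) (pathIndex_pathPos _ _ _)
    exact (pathPos_lt _ _ _).trans (by omega)
  · refine h.disjoint 0 h.length_pos (pathPos j k (pathIndex i ℓ 0)) ?_
      (pathIndex_pathPos _ _ _).symm
    exact (pathPos_lt _ _ _).trans (by omega)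

theorem IsSingularBigon.natAbs_eq (hS : S.IsQuadSystem) (hgeo : S.IsGeodesic c)
    (h : S.IsSingularBigon c left i ℓ j k) : k.natAbs = ℓ := by
  obtain ⟨h1, h2⟩ := h.length_le
  simpa using (natAbs_eq_of_homotopic hS hgeo (k := ℓ) (by simpa using h1) h2 h.homotopic).symm

theorem IsSingularBigon.disjointSides (hS : S.IsQuadSystem) (hgeo : S.IsGeodesic c)
    (h : S.IsSingularBigon c left i ℓ j k) : DisjointSides i ℓ j k where
  pos := h.length_pos
  natAbs_eq := h.natAbs_eq hS hgeo
  disjoint p hp q hq := h.disjoint p hp q (by rwa [h.natAbs_eq hS hgeo])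

omit [NeZero n] in
theorem natCast_ne_zero_of_lt (h0 : 0 < ℓ) (h : ℓ < n) : (ℓ : ZMod n) ≠ 0 := fun e =>
  (Nat.le_of_dvd h0 ((ZMod.natCast_eq_zero_iff _ _).1 e)).not_gt h

/-- If consecutive sides had total length more than `n`, the later one would wrap around and meet
the first occurrence of the earlier one after `n - ℓ` steps. -/
theorem DisjointSides.add_self_le (h : DisjointSides i ℓ j ℓ) (hij : j = i + ℓ ∨ i = j + ℓ) :
    ℓ + ℓ ≤ n := by
  by_contra hlt
  have hn := h.lt
  have hp := h.pos
  have e : ((n - ℓ : ℕ) : ZMod n) = -(ℓ : ZMod n) := by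
    rw [Nat.cast_sub hn.le, ZMod.natCast_self, zero_sub]
  rcases hij with rfl | rfl
  · refine h.disjoint 0 hp (n - ℓ) (by omega) ?_
    simp [pathIndex, hp, e]
  · refine h.disjoint (n - ℓ) (by omega) 0 hp ?_
    simp [pathIndex, hp, e]

theorem IsSingularBigon.isClosedCurve_swap [Finite A] (hI : S.IsImmersion c left)
    (h : S.IsSingularBigon c left i ℓ j k) (D : DisjointSides i ℓ j k) (hc : S.IsClosedCurve c) :
    S.IsClosedCurve (S.swapCurve c i ℓ j k) := by
  have h1 := ((isCrossing_iff hI).1 h.tip_start).org_eq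
  have h2 := ((isCrossing_iff hI).1 h.tip_end).org_eq
  rcases Int.natAbs_eq k with hk | hk <;> rw [D.natAbs_eq] at hk <;> subst hk
  · rw [Int.cast_natCast] at h2
    refine D.isClosedCurve_swap hc ?_ ?_
    · rw [outDart_zero D.pos, outDart_zero D.pos, h1.1, h1.2.2]
    · rw [inDart_last D.pos, inDart_last D.pos, h2.2.1]
  · refine D.isClosedCurve_swap hc ?_ ?_
    · rw [outDart_zero D.pos, outDart_neg_zero, h1.1, h1.2.1]
    · rw [inDart_last D.pos, inDart_neg_last D.pos, h2.2.2]

/-- The initial arcs of the sides are equal or neighbours in the rotation, and the reversed final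
arcs differ from both, so no final dart lies in the gap between the initial ones. -/
theorem not_interleave_of_consecutive [Finite A] (hS : S.IsQuadSystem) (hgeo : S.IsGeodesic c)
    (hI : S.IsImmersion c left) {m : ZMod n} (hℓ : 0 < ℓ) (hn : ℓ + ℓ ≤ n) (hj : j = i + ℓ)
    (hm : m = j + ℓ) (h : (squareRelation hS).run (forwardPath c i ℓ) =
      (squareRelation hS).run (forwardPath c j ℓ)) :
    ¬ S.Interleave c left (fwd i) (fwd j) (bwd j) (bwd m) := by
  obtain ⟨h1, h2, h3, h4, h5⟩ := arcs_of_consecutive_homotopic hS hgeo hℓ hn hj hm h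
  rcases h1 with h1 | h1 | h1
  · exact not_interleave_of_rot hI (.inl h1) h2 h3 h4 h5
  · exact not_interleave_of_rot hI (.inr h1) h2 h3 h4 h5
  · exact fun h => not_interleave_of_rot hI (x := fwd j) (y := fwd i)
      (z := bwd j) (w := bwd m) (.inr h1) h3 h2 h5 h4 (h.swap_left hI)

open Equiv in
/-- Uncrossing both tips of a singular bigon. -/
theorem IsSingularBigon.chordCount_le [Finite A] (hS : S.IsQuadSystem) (hc : S.IsClosedCurve c)
    (hgeo : S.IsGeodesic c) (hprim : S.IsPrimitive c) (hI : S.IsImmersion c left)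
    (h : S.IsSingularBigon c left i ℓ j k) (D : DisjointSides i ℓ j k) :
    S.chordCount c left (D.tipPerm⁻¹ * partner n * D.tipPerm) + 16 ≤
      S.chordCount c left (partner n) := by
  have h1 := (isCrossing_iff hI).1 h.tip_start
  have h2 := (isCrossing_iff hI).1 h.tip_end
  have hpos := D.pos
  have hlt := D.lt
  have hℓ0 := natCast_ne_zero_of_lt hpos hlt
  have fb := fwd_ne_bwd (n := n)
  have bf : ∀ s t : ZMod n, bwd s ≠ fwd t := fun s t => (fb t s).symm
  have ff : ∀ {s t : ZMod n}, s ≠ t → fwd s ≠ fwd t := fun h => fwd_injective.ne h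
  have bb : ∀ {s t : ZMod n}, s ≠ t → bwd s ≠ bwd t := fun h => bwd_injective.ne h
  -- Conjugation by `tipPerm` is two nested uncrossings: the starting tip inside, the final tip
  -- outside.
  have e : D.tipPerm⁻¹ * partner n * D.tipPerm =
      swap (inDart i ℓ (ℓ - 1)) (inDart j k (ℓ - 1)) *
        (swap (outDart i ℓ 0) (outDart j k 0) * partner n *
          swap (outDart i ℓ 0) (outDart j k 0)) *
        swap (inDart i ℓ (ℓ - 1)) (inDart j k (ℓ - 1)) := by
    simp only [DisjointSides.tipPerm, mul_inv_rev, swap_inv, mul_assoc]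
  rw [e]
  have hself : ∀ s : ZMod n, s + ℓ ≠ s := fun s e => hℓ0 (by simpa using e)
  rcases Int.natAbs_eq k with hk | hk <;> rw [D.natAbs_eq] at hk <;> subst hk
  · rw [Int.cast_natCast] at h2
    rw [outDart_zero hpos, outDart_zero hpos, inDart_last hpos, inDart_last hpos]
    have hrun := h.homotopic.run_eq hS
    rw [imagePath_natCast, imagePath_natCast] at hrun
    by_cases hj : j = i + ℓ
    · have hn := D.add_self_le (.inl hj)
      -- Otherwise `2 * ℓ = n` and the curve consists of two homotopic closed halves, against
      -- primitivity.
      have him : i ≠ j + ℓ := by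
        intro hi
        have hdvd : (n : ℕ) ∣ ℓ + ℓ := by
          rw [← ZMod.natCast_eq_zero_iff]
          push_cast
          rw [hj, add_assoc] at hi
          simpa using hi.symm
        have hn' : ℓ + ℓ = n := le_antisymm hn (Nat.le_of_dvd (by omega) hdvd)
        have hh := h.homotopic
        rw [imagePath_natCast, imagePath_natCast, hj] at hh
        refine hprim.not_homotopic_halves hc hn' ?_ hh
        rw [← hj]
        exact h.tip_start.2.1
      have h2' : S.Interleave c left (bwd j) (fwd j) (bwd (j + ℓ)) (fwd (j + ℓ)) := by
        rwa [← hj] at h2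
      have hord := h.not_end_start hj
      rw [Int.cast_natCast] at hord
      rw [← hj]
      exact chordCount_uncross_consecutive hI him h1 h2'
        (not_interleave_of_consecutive hS hgeo hI hpos hn hj rfl hrun) hord
    by_cases hi : i = j + ℓ
    · have hn := D.add_self_le (.inr hi)
      have h2' : S.Interleave c left (bwd i) (fwd i) (bwd (i + ℓ)) (fwd (i + ℓ)) := by
        rw [← hi] at h2
        exact h2.symm hI
      have hord := h.not_start_end (by rwa [Int.cast_natCast])
      rw [← hi, swap_comm (bwd (i + (ℓ : ZMod n))), swap_comm (fwd i)]
      refine chordCount_uncross_consecutive hI hj (h1.symm hI) h2'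
        (not_interleave_of_consecutive hS hgeo hI hpos hn hi rfl hrun.symm) fun ho => hord ?_
      -- With the two sides exchanged, the forbidden order of the third condition is obtained by
      -- reversal and rotation.
      rcases ho with ho | ho
      · exact .inr (.of_rotate 4 (by simpa [List.rotate_cons_succ] using ho))
      · exact .inl (.of_rotate 2 (by simpa [List.rotate_cons_succ] using ho))
    -- The tips have no index in common, so the first uncrossing leaves the chords of the second tip
    -- untouched.
    · refine chordCount_uncross_two hI partner_partner ?_ ?_
      · rw [partner_fwd, partner_fwd]
        exact ((h1.swap_left hI).symm hI |>.swap_left hI).symm hI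
      · rw [swap_apply_of_ne_of_ne (bf _ _) (bf _ _), swap_apply_of_ne_of_ne (bf _ _) (bf _ _),
          partner_bwd, partner_bwd, swap_apply_of_ne_of_ne (ff (hself i)) (ff (Ne.symm hj)),
          swap_apply_of_ne_of_ne (ff (Ne.symm hi)) (ff (hself j))]
        exact h2
  · rw [outDart_zero hpos, outDart_neg_zero, inDart_last hpos, inDart_neg_last hpos]
    -- A backward side starting at `i + ℓ` would begin with the last occurrence of the first side.
    -- Hence sides of opposite directions are never consecutive.
    have hj : i + ℓ ≠ j := by
      rintro rfl
      refine D.disjoint (ℓ - 1) (by omega) 0 hpos ?_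
      have h0 : ¬ (ℓ : ℤ) < 0 := by omega
      simp [pathIndex, hpos, h0, Nat.cast_sub (show 1 ≤ ℓ from hpos)]
      ring
    have hi : j + ((-(ℓ : ℤ) : ℤ) : ZMod n) ≠ i := by
      rintro rfl
      apply hj
      push_cast
      ring
    have hself' : j + ((-(ℓ : ℤ) : ℤ) : ZMod n) ≠ j := fun e => hℓ0 (by simpa using e)
    refine chordCount_uncross_two hI partner_partner ?_ ?_
    · rw [partner_fwd, partner_bwd]
      exact h1.swap_left hI
    · rw [swap_apply_of_ne_of_ne (bf _ _) (bb hj), swap_apply_of_ne_of_ne (ff hi) (fb _ _),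
        partner_bwd, partner_fwd, swap_apply_of_ne_of_ne (ff (hself i)) (fb _ _),
        swap_apply_of_ne_of_ne (bf _ _) (bb hself')]
      exact ((h2.symm hI).swap_left hI).symm hI

end CombinatorialSurface

theorem mainTheorem8 {V A : Type*} [Finite A] (S : CombinatorialSurface V A)
    (hS : S.IsQuadSystem) {n : ℕ} [NeZero n] (c : ZMod n → A) (hc : S.IsClosedCurve c)
    (hgeo : S.IsGeodesic c) (hprim : S.IsPrimitive c)
    (left : A → ZMod n → ZMod n → Prop) (hI : S.IsImmersion c left)
    (i : ZMod n) (ℓ : ℕ) (j : ZMod n) (k : ℤ) (hB : S.IsSingularBigon c left i ℓ j k) :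
    k.natAbs = ℓ ∧
      S.IsClosedCurve (S.swapCurve c i ℓ j k) ∧
      S.IsImmersion (S.swapCurve c i ℓ j k)
        (CombinatorialSurface.swapOrder left i ℓ j k) ∧
      S.crossingNumber (S.swapCurve c i ℓ j k)
        (CombinatorialSurface.swapOrder left i ℓ j k) + 2 ≤ S.crossingNumber c left := by
  have D := hB.disjointSides hS hgeo
  have hI' := D.isImmersion_swap hI
  refine ⟨D.natAbs_eq, hB.isClosedCurve_swap hI D hc, hI', ?_⟩
  have h1 := CombinatorialSurface.crossingNumber_eq hI
  have h2 := CombinatorialSurface.crossingNumber_eq hI'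
  have h3 := D.chordCount_swap (S := S) (c := c) (left := left)
  have h4 := hB.chordCount_le hS hc hgeo hprim hI D
  -- A drop of `16` in ordered pairs of darts is a drop of two crossings.
  omega
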